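/- Let $\underline{C}$ be a triangulated category that has all small products, and let $C'$ be a (small) set of cocompact objects of $\underline{C}$ (that is, $\bigoplus_i\underline{C}(Y_i,X)\to\underline{C}(\prod_i Y_i,X)$ is bijective for all $X\in C'$ and all small families $(Y_i)$ of objects) such that $C'[1]\subset C'$ (up to isomorphism). Conventions. A class of objects is extension-closed if it contains $0$ and, for each distinguished triangle $A\to B\to D\to A[1]$ with $A,D$ in it, also $B$. For a class $P$ of objects, ${}^\perp P=\{Y:\underline{C}(Y,X)=0\ \forall X\in P\}$, and $\langle P\rangle$ is the smallest strict full triangulated subcategory containing $P$. The coenvelope of $P$ is the smallest class of objects that contains $P\cup\{0\}$, is closed under small products, and contains all homotopy limits of those sequences $\cdots\to Y_2\xrightarrow{\phi_2}Y_1\xrightarrow{\phi_1}Y_0$ for which it contains $Y_0$ and $\mathrm{Cone}(\phi_i)[-1]$ for all $i\ge 1$; here a homotopy limit of $(Y_i)$ is a cone of $d[-1]$, where $d=\mathrm{id}-\prod\phi_i:\prod Y_i\to\prod Y_i$. A weight structure $w$ on a triangulated category $\underline{D}$ is a pair of retract-closed classes $\underline{D}_{w\le 0},\underline{D}_{w\ge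 0}$ of objects with $\underline{D}_{w\le 0}\subset\underline{D}_{w\le 0}[1]$, $\underline{D}_{w\ge 0}[1]\subset\underline{D}_{w\ge 0}$, $\underline{D}(X,Y)=0$ for $X\in\underline{D}_{w\le 0}$, $Y\in\underline{D}_{w\ge 0}[1]$, and such that each object $M$ has a weight decomposition, i.e. a distinguished triangle $B\to M\to A\to B[1]$ with $B\in\underline{D}_{w\le 0}$, $A\in\underline{D}_{w\ge 0}[1]$. Put $\underline{D}_{w\le n}=\underline{D}_{w\le 0}[n]$, $\underline{D}_{w\ge n}=\underline{D}_{w\ge 0}[n]$. The heart $\underline{Hw}$ is the full subcategory with object class $\underline{D}_{w\le 0}\cap\underline{D}_{w\ge 0}$; $w$ is non-degenerate from below if $\bigcap_l\underline{D}_{w\le l}=\{0\}$. A weight Postnikov tower for $M$ consists of objects $Y_i$ ($i\in\mathbb{Z}$), compatible morphisms $Y_{i-1}\to Y_i$ and $Y_i\to M$, and distinguished triangles $Y_{i-1}\to Y_i\to M_i\to Y_{i-1}[1]$, such that each $Y_i\to M$ extends to a distinguished triangle $Y_i\to M\to A_i\to Y_i[1]$ with $Y_i\in\underline{D}_{w\le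 i}$, $A_i\in\underline{D}_{w\ge i+1}$; the corresponding weight complex $t(M)$ has terms $M^p=M_{-p}[p]$ and differentials induced by the compositions $M_i\to Y_{i-1}[1]\to M_{i-1}[1]$. **Theorem.** Let $C_1={}^\perp(C'[1])$ and let $C_2$ be the coenvelope of $C'$. I. There is a weight structure $w$ on $\underline{C}$ with $\underline{C}_{w\le 0}=C_1$ and $\underline{C}_{w\ge 0}=C_2$. II. Let $\underline{C}'$ be the full subcategory of $\underline{C}$ whose class of objects is the coenvelope of $\bigcup_{i\le 0}C'[i]$, let $\underline{C}_\perp={}^\perp\langle C'\rangle$, and let $C_1'=C_1\cap\mathrm{Obj}\,\underline{C}'$. 1. $\underline{C}'$ and $\underline{C}_\perp$ are triangulated subcategories closed under all small products; moreover $\underline{C}'$ is the smallest strict full triangulated subcategory that contains $C'$ and is closed under small products (i.e. it is the subcategory cogenerated by $C'$). 2. $C_2\subset\mathrm{Obj}\,\underline{C}'$, and $(C_1',C_2)$ is a weight structure $w_{\underline{C}'}$ on $\underline{C}'$. 3. $w_{\underline{C}'}$ is non-degenerate from below. 4. $C_1$ is the smallest extension-closed class containing $C_1'\cup\mathrm{Obj}\,\underline{C}_\perp$.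 5. $C_1'$ is closed under all small products. 6. The heart of $w_{\underline{C}'}$ is closed under all small products; small products of weight decompositions (resp. of weight Postnikov towers) in $\underline{C}'$ are weight decompositions (resp. weight Postnikov towers), and small products of weight complexes of objects $M_i$ of $\underline{C}'$ are weight complexes of $\prod M_i$. 7. $\underline{C}$, $\underline{C}'$, $C_1$, $C_1'$ and $C_2$ (as full subcategories of $\underline{C}$) are idempotent complete. III. Every object of $\underline{C}'$ has a weight complex with respect to $w_{\underline{C}'}$. For each $c\in C'$ fix a weight complex $(c^i)_{i\in\mathbb{Z}}$. Then the heart $\underline{Hw}_{\underline{C}'}$ is equivalent to the Karoubization of the full subcategory of all small products of objects $c^i$ ($c\in C'$, $i\in\mathbb{Z}$), by an equivalence that extends the inclusion of this subcategory. -/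

import Mathlib

open CategoryTheory CategoryTheory.Limits CategoryTheory.Pretriangulated

universe v u

namespace WeightStr

section Basic

variable {C : Type u} [Category.{v} C]

/-- The class `P[n]`: all objects isomorphic to `X⟦n⟧` for some `X` in `P`. -/
abbrev translate [HasShift C ℤ] (P : ObjectProperty C) (n : ℤ) : ObjectProperty C :=
  P.map (shiftFunctor C n)

/-- `P` is closed under all small products that exist in `C`. -/
def ClosedUnderSmallProducts (P : ObjectProperty C) : Prop :=
  ∀ I : Type v, P.IsClosedUnderLimitsOfShape (Discrete I)

/-- The class of all small products of objects of `P`. -/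
def smallProducts (P : ObjectProperty C) : ObjectProperty C :=
  fun X => ∃ I : Type v, P.limitsOfShape (Discrete I) X

open Classical in
/-- The canonical homomorphism from the direct sum of the groups `C(Y i, X)` to `C(∏ Y i, X)`,
for a product cone `c` of the family `Y`. -/
noncomputable def cocompactComparison [Preadditive C] {I : Type v} {Y : I → C} (c : Fan Y)
    (X : C) : DirectSum I (fun i => (Y i ⟶ X)) →+ (c.pt ⟶ X) :=
  DirectSum.toAddMonoid (fun i => Preadditive.leftComp X (c.proj i))

/-- `X` is cocompact: `C(-, X)` takes small products to direct sums. -/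
def IsCocompact [Preadditive C] (X : C) : Prop :=
  ∀ (I : Type v) (Y : I → C) (c : Fan Y), IsLimit c →
    Function.Bijective (cocompactComparison c X)

end Basic

section Triangulated

variable {C : Type u} [Category.{v} C] [Preadditive C] [HasZeroObject C] [HasShift C ℤ]
  [∀ n : ℤ, (shiftFunctor C n).Additive] [Pretriangulated C]

/-- `X` is a homotopy limit of the sequence `⋯ ⟶ Y 2 ⟶ Y 1 ⟶ Y 0`: there is a distinguished
triangle `X ⟶ ∏ Y i ⟶ ∏ Y i ⟶ X⟦1⟧` whose second morphism `d` is the identity minus the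
morphism induced by the `φ i`. Equivalently, `X` is a cone of `d⟦-1⟧`. -/
def IsHomotopyLimit (Y : ℕ → C) (φ : ∀ i, Y (i + 1) ⟶ Y i) (X : C) : Prop :=
  ∃ (c : Fan Y) (_ : IsLimit c) (f : X ⟶ c.pt) (d : c.pt ⟶ c.pt) (h : c.pt ⟶ X⟦(1 : ℤ)⟧),
    (∀ i, d ≫ c.proj i = c.proj i - c.proj (i + 1) ≫ φ i) ∧
      Triangle.mk f d h ∈ distTriang C

/-- The closure properties in the definition of a coenvelope. -/
structure IsCoenvelopeClosed (Q : ObjectProperty C) : Prop where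
  zero : ∀ X, IsZero X → Q X
  prod : ClosedUnderSmallProducts Q
  holim : ∀ (Y : ℕ → C) (φ : ∀ i, Y (i + 1) ⟶ Y i), Q (Y 0) →
    (∀ i, ∃ (Z : C) (g : Y i ⟶ Z) (h : Z ⟶ (Y (i + 1))⟦(1 : ℤ)⟧),
      Triangle.mk (φ i) g h ∈ distTriang C ∧ Q (Z⟦(-1 : ℤ)⟧)) →
    ∀ X, IsHomotopyLimit Y φ X → Q X

/-- The coenvelope of `P`: the smallest class containing `P` and the zero objects, closed under
small products, and containing every homotopy limit of a sequence `Y` such that `Y 0` and all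
`Cone (Y (i + 1) ⟶ Y i)⟦-1⟧` belong to it. -/
def coenvelope (P : ObjectProperty C) : ObjectProperty C :=
  fun X => ∀ Q : ObjectProperty C, IsCoenvelopeClosed Q → P ≤ Q → Q X

/-- `Q` is extension-closed. -/
structure IsExtensionClosed (Q : ObjectProperty C) : Prop where
  zero : ∀ X, IsZero X → Q X
  ext : ∀ T ∈ distTriang C, Q T.obj₁ → Q T.obj₃ → Q T.obj₂

/-- The smallest extension-closed class containing `P`. -/
def extensionClosure (P : ObjectProperty C) : ObjectProperty C :=
  fun X => ∀ Q : ObjectProperty C, IsExtensionClosed Q → P ≤ Q → Q X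

/-- The smallest strict full triangulated subcategory containing `P`. -/
def triangulatedClosure (P : ObjectProperty C) : ObjectProperty C :=
  fun X => ∀ Q : ObjectProperty C, Q.IsTriangulated → Q.IsClosedUnderIsomorphisms → P ≤ Q → Q X

variable (C) in
/-- A weight structure on `C` (in the homological convention); `le` is the class `C_{w ≤ 0}`
and `ge` is the class `C_{w ≥ 0}`. -/
structure WeightStructure where
  le : ObjectProperty C
  ge : ObjectProperty C
  le_retract : le.IsStableUnderRetracts
  ge_retract : ge.IsStableUnderRetracts
  le_translate : le ≤ translate le 1
  translate_ge : translate ge 1 ≤ ge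
  orthogonal : ∀ ⦃X Y : C⦄, le X → translate ge 1 Y → ∀ f : X ⟶ Y, f = 0
  exists_decomposition : ∀ M : C, ∃ (B A : C) (b : B ⟶ M) (a : M ⟶ A) (f : A ⟶ B⟦(1 : ℤ)⟧),
    Triangle.mk b a f ∈ distTriang C ∧ le B ∧ translate ge 1 A

/-- The raw data underlying a Postnikov tower for `M`: objects `Y i`, morphisms
`Y i ⟶ M`, and sequences `Y (i - 1) ⟶ Y i ⟶ G i ⟶ (Y (i - 1))⟦1⟧`. -/
structure TowerData (M : C) where
  Y : ℤ → C
  G : ℤ → C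
  toObj (i : ℤ) : Y i ⟶ M
  map (j i : ℤ) (h : j + 1 = i) : Y j ⟶ Y i
  proj (i : ℤ) : Y i ⟶ G i
  δ (i j : ℤ) (h : j + 1 = i) : G i ⟶ (Y j)⟦(1 : ℤ)⟧

namespace TowerData

variable {M : C}

/-- The data `P` form an (unbounded) Postnikov tower for `M`. -/
structure IsPostnikov (P : TowerData M) : Prop where
  comm : ∀ (j i : ℤ) (h : j + 1 = i), P.map j i h ≫ P.toObj i = P.toObj j
  dist : ∀ (j i : ℤ) (h : j + 1 = i),
    Triangle.mk (P.map j i h) (P.proj i) (P.δ i j h) ∈ distTriang C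

/-- The differential `(G (-p))⟦p⟧ ⟶ (Y (-q))⟦1⟧⟦p⟧ ⟶ (G (-q))⟦1⟧⟦p⟧ ≅ (G (-q))⟦q⟧`
for `q = p + 1`. -/
noncomputable def d (P : TowerData M) (p q : ℤ) (h : p + 1 = q) :
    (P.G (-p))⟦p⟧ ⟶ (P.G (-q))⟦q⟧ :=
  (P.δ (-p) (-q) (by omega) ≫ (P.proj (-q))⟦(1 : ℤ)⟧')⟦p⟧' ≫
    (shiftFunctorAdd' C 1 p q (by omega)).inv.app (P.G (-q))

lemma IsPostnikov.d_comp_d {P : TowerData M} (hP : P.IsPostnikov) (p q r : ℤ)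
    (h : p + 1 = q) (h' : q + 1 = r) : P.d p q h ≫ P.d q r h' = 0 := by
  have h0 : P.proj (-q) ≫ P.δ (-q) (-r) (by omega) = 0 :=
    comp_distTriang_mor_zero₂₃ _ (hP.dist (-r) (-q) (by omega))
  have key : (P.proj (-q))⟦(1 : ℤ)⟧'⟦p⟧' ≫
      (shiftFunctorAdd' C 1 p q (by omega)).inv.app (P.G (-q)) ≫
        (P.δ (-q) (-r) (by omega))⟦q⟧' = 0 := by
    have e := (shiftFunctorAdd' C 1 p q (by omega)).inv.naturality (P.δ (-q) (-r) (by omega))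
    rw [← e]
    simp only [Functor.comp_map, ← Category.assoc, ← Functor.map_comp, h0, Functor.map_zero,
      zero_comp]
  simp only [d, Functor.map_comp, Category.assoc]
  rw [reassoc_of% key]
  simp

/-- The complex of a Postnikov tower; its `p`-th term is `M^p = (G (-p))⟦p⟧`. -/
noncomputable def complex (P : TowerData M) (hP : P.IsPostnikov) : CochainComplex C ℤ :=
  CochainComplex.of (fun p : ℤ => (P.G (-p))⟦p⟧) (fun p => P.d p (p + 1) rfl)
    (fun p => hP.d_comp_d p (p + 1) (p + 1 + 1) rfl rfl)

/-- A morphism of towers over a morphism `f : M ⟶ M'`. -/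
structure Hom {M' : C} (P : TowerData M) (P' : TowerData M') (f : M ⟶ M') where
  homY (i : ℤ) : P.Y i ⟶ P'.Y i
  homG (i : ℤ) : P.G i ⟶ P'.G i
  comm_toObj (i : ℤ) : P.toObj i ≫ f = homY i ≫ P'.toObj i
  comm_map (j i : ℤ) (h : j + 1 = i) : P.map j i h ≫ homY i = homY j ≫ P'.map j i h
  comm_proj (i : ℤ) : P.proj i ≫ homG i = homY i ≫ P'.proj i
  comm_δ (i j : ℤ) (h : j + 1 = i) : P.δ i j h ≫ (homY j)⟦(1 : ℤ)⟧' = homG i ≫ P'.δ i j h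

end TowerData

/-- The morphisms `p i : X ⟶ F i` exhibit `X` as the product of the family `F`. -/
def IsProductOf {D : Type*} [Category D] {I : Type v} {X : D} {F : I → D}
    (p : ∀ i, X ⟶ F i) : Prop :=
  Nonempty (IsLimit (Fan.mk X p))

namespace WeightStructure

variable (w : WeightStructure C)

/-- `C_{w ≤ n} = C_{w ≤ 0}[n]`. -/
def leN (n : ℤ) : ObjectProperty C := translate w.le n

/-- `C_{w ≥ n} = C_{w ≥ 0}[n]`. -/
def geN (n : ℤ) : ObjectProperty C := translate w.ge n

/-- The class `C_{w = 0}` of objects of the heart. -/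
def heart : ObjectProperty C := w.ge ⊓ w.le

/-- The intersection of all `C_{w ≤ l}` consists of the zero objects. -/
def NonDegenerateFromBelow : Prop :=
  ∀ X : C, (∀ l : ℤ, w.leN l X) ↔ IsZero X

/-- `T` is a distinguished triangle `w_{≤ n} M ⟶ M ⟶ w_{≥ n + 1} M ⟶ (w_{≤ n} M)⟦1⟧`;
for `n = 0` it is a weight decomposition of `M = T.obj₂`. -/
structure IsDecomposition (n : ℤ) (T : Triangle C) : Prop where
  dist : T ∈ distTriang C
  le : w.leN n T.obj₁
  ge : w.geN (n + 1) T.obj₃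

/-- `P` is a weight Postnikov tower: it is a Postnikov tower, and every `Y j ⟶ M` is a choice
of `w_{≤ j} M`. -/
structure IsWeightTower {M : C} (P : TowerData M) : Prop where
  postnikov : P.IsPostnikov
  decomposition : ∀ j : ℤ, ∃ (A : C) (a : M ⟶ A) (f : A ⟶ (P.Y j)⟦(1 : ℤ)⟧),
    w.IsDecomposition j (Triangle.mk (P.toObj j) a f)

/-- `K` is a weight complex for `M`, i.e. it is (isomorphic to) the complex of a weight
Postnikov tower for `M`. -/
def IsWeightComplex (M : C) (K : CochainComplex C ℤ) : Prop :=
  ∃ (P : TowerData M) (hP : w.IsWeightTower P), Nonempty (K ≅ P.complex hP.postnikov)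

/-- Small products of weight decompositions are weight decompositions. -/
def ProductsOfDecompositions : Prop :=
  ∀ (n : ℤ) (I : Type v) (T : Triangle C) (T' : I → Triangle C) (π : ∀ i, T ⟶ T' i),
    IsProductOf (fun i => (π i).hom₁) → IsProductOf (fun i => (π i).hom₂) →
    IsProductOf (fun i => (π i).hom₃) → (∀ i, w.IsDecomposition n (T' i)) →
    w.IsDecomposition n T

/-- Small products of weight Postnikov towers are weight Postnikov towers. -/
def ProductsOfWeightTowers : Prop :=
  ∀ (I : Type v) (M : C) (M' : I → C) (f : ∀ i, M ⟶ M' i) (P : TowerData M)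
    (P' : ∀ i, TowerData (M' i)) (π : ∀ i, P.Hom (P' i) (f i)),
    IsProductOf f → (∀ j : ℤ, IsProductOf (fun i => (π i).homY j)) →
    (∀ j : ℤ, IsProductOf (fun i => (π i).homG j)) → (∀ i, w.IsWeightTower (P' i)) →
    w.IsWeightTower P

/-- Small products of weight complexes of objects `M' i` are weight complexes of the product of
the `M' i`. -/
def ProductsOfWeightComplexes : Prop :=
  ∀ (I : Type v) (M : C) (M' : I → C) (f : ∀ i, M ⟶ M' i) (K : CochainComplex C ℤ)
    (K' : I → CochainComplex C ℤ) (π : ∀ i, K ⟶ K' i),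
    IsProductOf f → IsProductOf π → (∀ i, w.IsWeightComplex (M' i) (K' i)) →
    w.IsWeightComplex M K

end WeightStructure

/-- `C₁ = ⊥(S[1])`. -/
def classOne (S : ObjectProperty C) : ObjectProperty C := (translate S 1).leftOrthogonal

/-- The coenvelope of the union of all `S[i]`, `i ≤ 0`. -/
def cogen (S : ObjectProperty C) : ObjectProperty C :=
  coenvelope (fun X => ∃ i : ℤ, i ≤ 0 ∧ translate S i X)

/-- `⊥⟨S⟩`. -/
def perp (S : ObjectProperty C) : ObjectProperty C := (triangulatedClosure S).leftOrthogonal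

end Triangulated

end WeightStr

set_option linter.unusedSectionVars false

/-! The core is `exists_orthogonal_decomposition`: for an essentially small class `P` of cocompact
objects, every `M` lies in a triangle `L ⟶ M ⟶ A` with `L` left orthogonal to `P` and `A` in the
coenvelope of `P`. This is a dual small object argument. Start from `L₀ = M` and let `Lₙ₊₁` be the
fibre of a map from `Lₙ` to a product of objects of `P` through which every morphism from `Lₙ` to
`P` factors. By the octahedral axiom the cones `Aₙ` of `Lₙ ⟶ M` form a sequence whose fibres are
these products, and `A` is its homotopy limit. Cocompactness makes each morphism from `A` to some
`X⟦1⟧`, `X` in `P`, factor through a finite stage (`exists_holim_factor`), which gives the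
orthogonality of `L`.

For `P = S[1]` these triangles are weight decompositions. For `P` the nonpositive shifts of `S`,
which up to isomorphism are all its shifts, they split every object into a part in `perp S` and a
part in `cogen S`. Orthogonality of the two weight classes is a vanishing of lim¹
(`rightOrthogonal_shift_isCoenvelopeClosed`), and closure under retracts is an Eilenberg swindle
(`exists_splitting`). Since `cogen S` contains the coenvelope of `S`, the weight structure restricts
to it.

For the heart, let `H` consist of the retracts of products of terms of the chosen weight complexes.
The objects `M` of nonnegative weight having a triangle `B ⟶ M ⟶ A` with `B` in `H` and `A` of
weight at least 1 form a class closed under the coenvelope operations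
(`approximable_isCoenvelopeClosed`), and the generators belong to it. If `M` is in the heart, `M ⟶
A` vanishes and `M` is a retract of `B`. Idempotent completeness then identifies the heart with the
Karoubi envelope. -/

namespace WeightStr

/-! ### Classes closed under small products. -/

section Products

variable {C : Type u} [Category.{v} C]

lemma ClosedUnderSmallProducts.nat {Q : ObjectProperty C} (hQ : ClosedUnderSmallProducts Q) :
    Q.IsClosedUnderLimitsOfShape (Discrete ℕ) := by
  have := hQ (ULift.{v} ℕ)
  exact ObjectProperty.IsClosedUnderLimitsOfShape.of_equivalence
    (Discrete.equivalence Equiv.ulift)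

lemma ClosedUnderSmallProducts.fan {Q : ObjectProperty C} (hQ : ClosedUnderSmallProducts Q)
    {I : Type v} {Y : I → C} {c : Fan Y} (hc : IsLimit c) (h : ∀ i, Q (Y i)) : Q c.pt := by
  have := hQ I
  exact Q.prop_of_isLimit hc (fun i => h i.as)

lemma ClosedUnderSmallProducts.pi {Q : ObjectProperty C} (hQ : ClosedUnderSmallProducts Q)
    {I : Type v} (Y : I → C) [HasProduct Y] (h : ∀ i, Q (Y i)) : Q (∏ᶜ Y) := by
  have := hQ I
  exact Q.prop_pi Y h

lemma ClosedUnderSmallProducts.nat_fan {Q : ObjectProperty C} (hQ : ClosedUnderSmallProducts Q)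
    {Y : ℕ → C} {c : Fan Y} (hc : IsLimit c) (h : ∀ i, Q (Y i)) : Q c.pt := by
  have := hQ.nat
  exact Q.prop_of_isLimit hc (fun i => h i.as)

lemma ClosedUnderSmallProducts.of_fan {Q : ObjectProperty C}
    (hQ : ∀ (I : Type v) (Y : I → C) (c : Fan Y), IsLimit c → (∀ i, Q (Y i)) → Q c.pt) :
    ClosedUnderSmallProducts Q := by
  intro I
  refine ⟨fun X ⟨h⟩ => ?_⟩
  let e := Discrete.natIsoFunctor (F := h.diag)
  exact hQ I (fun i => h.diag.obj ⟨i⟩)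
    ((Cone.postcompose e.hom).obj (Cone.mk X h.π))
    ((IsLimit.postcomposeHomEquiv e _).symm h.isLimit) (fun i => h.prop_diag_obj ⟨i⟩)

/-- An object isomorphic to `X` is a product of the one-member family `X`. -/
lemma ClosedUnderSmallProducts.isClosedUnderIsomorphisms {Q : ObjectProperty C}
    (hQ : ClosedUnderSmallProducts Q) : Q.IsClosedUnderIsomorphisms where
  of_iso {X Y} e hX := by
    refine hQ.fan (I := PUnit) (Y := fun _ => X) (c := Fan.mk Y (fun _ => e.inv))
      (Fan.IsLimit.mk _ (fun s => s.proj ⟨⟩ ≫ e.hom) ?_ ?_) (fun _ => hX)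
    · intro s j
      simp [Fan.proj]
    · intro s m hm
      rw [← hm ⟨⟩]
      simp [Fan.proj]

lemma ClosedUnderSmallProducts.inf {P Q : ObjectProperty C}
    (hP : ClosedUnderSmallProducts P) (hQ : ClosedUnderSmallProducts Q) :
    ClosedUnderSmallProducts (P ⊓ Q) :=
  .of_fan fun _ _ _ hc h => ⟨hP.fan hc (fun i => (h i).1), hQ.fan hc (fun i => (h i).2)⟩

/-- The uniqueness part of the universal property of a fan. -/
lemma fan_hom_ext {I : Type*} {Y : I → C} {c : Fan Y} (hc : IsLimit c) {X : C}
    {f g : X ⟶ c.pt} (h : ∀ i, f ≫ c.proj i = g ≫ c.proj i) : f = g :=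
  Fan.IsLimit.hom_ext hc _ _ h

/-- The existence part of the universal property of a fan. -/
lemma exists_fan_lift {I : Type*} {Y : I → C} {c : Fan Y} (hc : IsLimit c) {X : C}
    (f : ∀ i, X ⟶ Y i) : ∃ g : X ⟶ c.pt, ∀ i, g ≫ c.proj i = f i :=
  ⟨Fan.IsLimit.lift hc f, fun i => Fan.IsLimit.fac hc f i⟩

/-- The image of a limit fan under a functor that preserves it. -/
lemma nonempty_isLimit_map_fan {D : Type*} [Category* D] (F : C ⥤ D) {I : Type*} {Y : I → C}
    {c : Fan Y} (hc : IsLimit c) [PreservesLimit (Discrete.functor Y) F] :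
    Nonempty (IsLimit
      (Fan.mk (F.obj c.pt) (fun i => F.map (c.proj i)) : Fan fun i => F.obj (Y i))) :=
  ⟨isLimitFanMkObjOfIsLimit F Y c.proj (hc.ofIsoLimit (Cone.ext (Iso.refl _) (fun ⟨i⟩ => by
    simp [Fan.proj])))⟩

lemma translate_iff [HasShift C ℤ] (P : ObjectProperty C) [P.IsClosedUnderIsomorphisms]
    (n : ℤ) (X : C) : translate P n X ↔ P (X⟦-n⟧) := by
  constructor
  · rintro ⟨Y, hY, ⟨e⟩⟩
    exact P.prop_of_iso ((shiftShiftNeg Y n).symm ≪≫ (shiftFunctor C (-n)).mapIso e) hY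
  · intro h
    exact ⟨_, h, ⟨shiftNegShift X n⟩⟩

lemma exists_id_sub_shift [Preadditive C] {Y : ℕ → C} (φ : ∀ i, Y (i + 1) ⟶ Y i) {c : Fan Y}
    (hc : IsLimit c) : ∃ d : c.pt ⟶ c.pt, ∀ i, d ≫ c.proj i = c.proj i - c.proj (i + 1) ≫ φ i :=
  exists_fan_lift hc (fun i => (c.proj i - c.proj (i + 1) ≫ φ i : c.pt ⟶ Y i))

end Products

/-! ### Exactness in distinguished triangles and splitting of idempotents. -/

section Triangulated

variable {C : Type u} [Category.{v} C] [Preadditive C] [HasZeroObject C] [HasShift C ℤ]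
  [∀ n : ℤ, (shiftFunctor C n).Additive] [Pretriangulated C]

lemma exists_fiber_factor {X Y Z W : C} {f : X ⟶ Y} {g : Y ⟶ Z} {h : Z ⟶ X⟦(1 : ℤ)⟧}
    (hT : Triangle.mk f g h ∈ distTriang C) (k : W ⟶ Y) (hk : k ≫ g = 0) :
    ∃ l : W ⟶ X, l ≫ f = k := by
  obtain ⟨l, hl⟩ := Triangle.coyoneda_exact₂ _ hT k hk
  exact ⟨l, hl.symm⟩

lemma exists_cone_factor {X Y Z W : C} {f : X ⟶ Y} {g : Y ⟶ Z} {h : Z ⟶ X⟦(1 : ℤ)⟧}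
    (hT : Triangle.mk f g h ∈ distTriang C) (k : Y ⟶ W) (hk : f ≫ k = 0) :
    ∃ l : Z ⟶ W, g ≫ l = k := by
  obtain ⟨l, hl⟩ := Triangle.yoneda_exact₂ _ hT k hk
  exact ⟨l, hl.symm⟩

lemma exists_connecting_factor {X Y Z W : C} {f : X ⟶ Y} {g : Y ⟶ Z} {h : Z ⟶ X⟦(1 : ℤ)⟧}
    (hT : Triangle.mk f g h ∈ distTriang C) (k : Z ⟶ W) (hk : g ≫ k = 0) :
    ∃ l : X⟦(1 : ℤ)⟧ ⟶ W, h ≫ l = k := by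
  obtain ⟨l, hl⟩ := Triangle.yoneda_exact₃ _ hT k hk
  exact ⟨l, hl.symm⟩

lemma exists_lift_of_comp_connecting {X Y Z W : C} {f : X ⟶ Y} {g : Y ⟶ Z} {h : Z ⟶ X⟦(1 : ℤ)⟧}
    (hT : Triangle.mk f g h ∈ distTriang C) (k : W ⟶ Z) (hk : k ≫ h = 0) :
    ∃ l : W ⟶ Y, l ≫ g = k := by
  obtain ⟨l, hl⟩ := Triangle.coyoneda_exact₃ _ hT k hk
  exact ⟨l, hl.symm⟩

lemma rot_mk {X Y Z : C} {f : X ⟶ Y} {g : Y ⟶ Z} {h : Z ⟶ X⟦(1 : ℤ)⟧}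
    (hT : Triangle.mk f g h ∈ distTriang C) : Triangle.mk g h (-f⟦(1 : ℤ)⟧') ∈ distTriang C :=
  rot_of_distTriang _ hT

lemma inv_rot_mk {X Y Z : C} {f : X ⟶ Y} {g : Y ⟶ Z} {h : Z ⟶ X⟦(1 : ℤ)⟧}
    (hT : Triangle.mk f g h ∈ distTriang C) :
    ∃ (k : Z⟦(-1 : ℤ)⟧ ⟶ X) (l : Y ⟶ Z⟦(-1 : ℤ)⟧⟦(1 : ℤ)⟧), Triangle.mk k f l ∈ distTriang C :=
  ⟨_, _, inv_rot_of_distTriang _ hT⟩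

lemma split_distinguished {A B D : C} {k : A ⟶ B} {l : B ⟶ A} {p : B ⟶ D} {s : D ⟶ B}
    (hkl : k ≫ l = 𝟙 A) (hsp : s ≫ p = 𝟙 D) (hkp : k ≫ p = 0) (hlk : l ≫ k + p ≫ s = 𝟙 B) :
    Triangle.mk k p (0 : D ⟶ A⟦(1 : ℤ)⟧) ∈ distTriang C := by
  -- The one biproduct identity that is not assumed follows from the other four.
  have hsl : s ≫ l = 0 := by
    have h1 : s ≫ (l ≫ k + p ≫ s) = s := by rw [hlk, Category.comp_id]
    rw [Preadditive.comp_add, ← Category.assoc s p s, hsp, Category.id_comp] at h1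
    have h2 : s ≫ l ≫ k = 0 := by simpa using h1
    have h3 : (s ≫ l ≫ k) ≫ l = 0 := by rw [h2, zero_comp]
    simpa [hkl] using h3
  let e : B ≅ A ⊞ D :=
    { hom := biprod.lift l p
      inv := biprod.desc k s
      hom_inv_id := by rw [biprod.lift_desc, hlk]
      inv_hom_id := by ext <;> simp [hkl, hsp, hkp, hsl] }
  refine isomorphic_distinguished _ (binaryBiproductTriangle_distinguished A D) _
    (Triangle.isoMk _ _ (Iso.refl _) e (Iso.refl _) ?_ ?_ ?_)
  · change k ≫ biprod.lift l p = 𝟙 A ≫ biprod.inl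
    ext <;> simp [hkl, hkp]
  · change p ≫ 𝟙 D = biprod.lift l p ≫ biprod.snd
    simp
  · change 0 ≫ _ = 𝟙 D ≫ 0
    simp

/-- The Eilenberg swindle: in the presence of countable powers an idempotent `e` of `A` splits,
and its image is a cone of an endomorphism of the countable power of `A`. -/
lemma exists_splitting [HasProductsOfShape ℕ C] {A : C} {e : A ⟶ A} (he : e ≫ e = e) :
    ∃ (W : C) (i : W ⟶ A) (r : A ⟶ W), i ≫ r = 𝟙 W ∧ r ≫ i = e ∧
      ∃ (k : (∏ᶜ fun _ : ℕ => A) ⟶ ∏ᶜ fun _ : ℕ => A) (g : (∏ᶜ fun _ : ℕ => A) ⟶ W)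
        (h : W ⟶ (∏ᶜ fun _ : ℕ => A)⟦(1 : ℤ)⟧), Triangle.mk k g h ∈ distTriang C := by
  let P := ∏ᶜ fun _ : ℕ => A
  let π (j : ℕ) : P ⟶ A := Pi.π (fun _ : ℕ => A) j
  have hext {T : C} {f g : T ⟶ P} (h : ∀ j, f ≫ π j = g ≫ π j) : f = g := Pi.hom_ext _ _ h
  -- `k` moves the `e`-part of each coordinate one place up and fixes the `(𝟙 - e)`-part; `l` moves
  -- it back. What `k` misses is the `e`-part of coordinate 0, so its cone is the image of `e`.
  obtain ⟨k, hk0, hk⟩ : ∃ k : P ⟶ P, k ≫ π 0 = π 0 ≫ (𝟙 A - e) ∧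
      ∀ j, k ≫ π (j + 1) = π j ≫ e + π (j + 1) ≫ (𝟙 A - e) :=
    ⟨Pi.lift (fun j => Nat.casesOn j (π 0 ≫ (𝟙 A - e))
      (fun j => π j ≫ e + π (j + 1) ≫ (𝟙 A - e))), by simp [π], fun j => by simp [π]⟩
  obtain ⟨l, hl⟩ : ∃ l : P ⟶ P, ∀ j, l ≫ π j = π j ≫ (𝟙 A - e) + π (j + 1) ≫ e :=
    ⟨Pi.lift (fun j => π j ≫ (𝟙 A - e) + π (j + 1) ≫ e), fun j => by simp [π]⟩
  obtain ⟨ι, hι0, hι⟩ : ∃ ι : A ⟶ P, ι ≫ π 0 = 𝟙 A ∧ ∀ j, ι ≫ π (j + 1) = 0 :=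
    ⟨Pi.lift (fun j => Nat.casesOn j (𝟙 A) (fun _ => 0)), by simp [π], fun j => by simp [π]⟩
  have he1 : e ≫ (𝟙 A - e) = 0 := by simp [he]
  have he2 : (𝟙 A - e) ≫ e = 0 := by simp [he]
  have he3 : (𝟙 A - e) ≫ (𝟙 A - e) = 𝟙 A - e := by simp [he]
  have hkl : k ≫ l = 𝟙 P := by
    refine hext fun j => ?_
    rw [Category.assoc, hl, Preadditive.comp_add, ← Category.assoc, ← Category.assoc, hk]
    cases j with
    | zero =>
      simp only [hk0, Preadditive.add_comp, Category.assoc, he, he2, he3]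
      simp
    | succ j =>
      simp only [hk, Preadditive.add_comp, Category.assoc, he, he1, he2, he3]
      simp
  have hlk : 𝟙 P - l ≫ k = π 0 ≫ e ≫ ι := by
    refine hext fun j => ?_
    cases j with
    | zero =>
      rw [Preadditive.sub_comp, Category.assoc, hk0, ← Category.assoc, hl]
      simp only [Preadditive.add_comp, Category.assoc, he1, he3, hι0]
      simp
    | succ j =>
      rw [Preadditive.sub_comp, Category.assoc, hk, Preadditive.comp_add, ← Category.assoc,
        ← Category.assoc, hl, hl]
      simp only [Preadditive.add_comp, Category.assoc, he, he1, he2, he3, hι]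
      simp
  obtain ⟨W, g, h, hT⟩ := distinguished_cocone_triangle k
  have hmono : Mono k := ⟨fun a b hab => by
    simpa [hkl] using congrArg (· ≫ l) hab⟩
  have hh : h = 0 := Triangle.mor₃_eq_zero_of_mono₁ _ hT hmono
  have hg : Epi g := Triangle.epi₂ _ hT hh
  have hkg : k ≫ g = 0 := comp_distTriang_mor_zero₁₂ _ hT
  obtain ⟨s, hs⟩ := exists_cone_factor hT (𝟙 P - l ≫ k)
    (by rw [Preadditive.comp_sub, ← Category.assoc, hkl]; simp)
  have hgg : (𝟙 P - l ≫ k) ≫ g = g := by simp [hkg]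
  refine ⟨W, s ≫ π 0, ι ≫ g, ?_, ?_, k, g, h, hT⟩
  · rw [← cancel_epi g]
    calc g ≫ (s ≫ π 0) ≫ ι ≫ g = (g ≫ s) ≫ π 0 ≫ ι ≫ g := by simp
      _ = π 0 ≫ e ≫ (ι ≫ π 0) ≫ ι ≫ g := by rw [hs, hlk]; simp
      _ = (π 0 ≫ e ≫ ι) ≫ g := by rw [hι0]; simp
      _ = g ≫ 𝟙 W := by rw [← hlk, hgg, Category.comp_id]
  · calc (ι ≫ g) ≫ s ≫ π 0 = ι ≫ (g ≫ s) ≫ π 0 := by simp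
      _ = (ι ≫ π 0) ≫ e ≫ (ι ≫ π 0) := by rw [hs, hlk]; simp
      _ = e := by rw [hι0]; simp

lemma isIdempotentComplete_of_hasCountablePowers [HasProductsOfShape ℕ C] :
    IsIdempotentComplete C where
  idempotents_split _ e he := by
    obtain ⟨W, i, r, h1, h2, -⟩ := exists_splitting he
    exact ⟨W, i, r, h1, h2⟩

lemma isIdempotentComplete_fullSubcategory {D : Type*} [Category* D] [IsIdempotentComplete D]
    (P : ObjectProperty D) [P.IsStableUnderRetracts] :
    IsIdempotentComplete P.FullSubcategory where
  idempotents_split X e he := by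
    obtain ⟨W, i, r, h1, h2⟩ := IsIdempotentComplete.idempotents_split X.obj e.hom
      (by simpa using congrArg (fun f => f.hom) he)
    refine ⟨⟨W, P.prop_of_retract ⟨i, r, h1⟩ X.property⟩, ⟨i⟩, ⟨r⟩, ?_, ?_⟩
    · ext; exact h1
    · ext; exact h2

/-- A class of objects closed under extensions, positive shifts and countable powers is closed
under retracts. -/
lemma isStableUnderRetracts_of_extensions [HasProductsOfShape ℕ C] {Q : ObjectProperty C}
    [Q.IsClosedUnderIsomorphisms] (hprod : ∀ A, Q A → Q (∏ᶜ fun _ : ℕ => A))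
    (hshift : ∀ A, Q A → Q (A⟦(1 : ℤ)⟧))
    (hext : ∀ T ∈ distTriang C, Q T.obj₁ → Q T.obj₃ → Q T.obj₂) : Q.IsStableUnderRetracts where
  of_retract {Y A} ρ hA := by
    obtain ⟨W, i, r, h1, h2, k, g, h, hT⟩ := exists_splitting (e := ρ.r ≫ ρ.i) (by simp)
    -- The rotated triangle presents `W` as an extension of the shifted power of `A` by the power
    -- itself. It is isomorphic to `Y`, since both split the same idempotent.
    have hW : Q W := hext _ (rot_of_distTriang _ hT) (hprod A hA) (hshift _ (hprod A hA))
    refine Q.prop_of_iso ⟨i ≫ ρ.r, ρ.i ≫ r, ?_, ?_⟩ hW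
    · calc (i ≫ ρ.r) ≫ ρ.i ≫ r = i ≫ (ρ.r ≫ ρ.i) ≫ r := by simp
        _ = (i ≫ r) ≫ i ≫ r := by rw [← h2]; simp
        _ = 𝟙 W := by rw [h1]; simp
    · calc (ρ.i ≫ r) ≫ i ≫ ρ.r = ρ.i ≫ (r ≫ i) ≫ ρ.r := by simp
        _ = (ρ.i ≫ ρ.r) ≫ ρ.i ≫ ρ.r := by rw [h2]; simp
        _ = 𝟙 Y := by simp

end Triangulated

/-! ### Homotopy limits and closure properties of coenvelopes. -/

section Coenvelope

variable {C : Type u} [Category.{v} C] [Preadditive C] [HasZeroObject C] [HasShift C ℤ]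
  [∀ n : ℤ, (shiftFunctor C n).Additive] [Pretriangulated C]

lemma coenvelope_isCoenvelopeClosed (P : ObjectProperty C) :
    IsCoenvelopeClosed (coenvelope P) where
  zero X hX Q hQ _ := hQ.zero X hX
  prod := .of_fan fun _ _ _ hc h Q hQ hP => hQ.prod.fan hc (fun i => h i Q hQ hP)
  holim Y φ h0 h X hX Q hQ hP := hQ.holim Y φ (h0 Q hQ hP)
    (fun i => by
      obtain ⟨Z, g, k, hT, hZ⟩ := h i
      exact ⟨Z, g, k, hT, hZ Q hQ hP⟩) X hX

lemma le_coenvelope (P : ObjectProperty C) : P ≤ coenvelope P := fun X hX _ _ hP => hP X hX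

lemma coenvelope_le {P Q : ObjectProperty C} (hQ : IsCoenvelopeClosed Q) (h : P ≤ Q) :
    coenvelope P ≤ Q := fun _ hX => hX Q hQ h

lemma coenvelope_mono {P Q : ObjectProperty C} (h : P ≤ coenvelope Q) :
    coenvelope P ≤ coenvelope Q := coenvelope_le (coenvelope_isCoenvelopeClosed Q) h

instance (P : ObjectProperty C) : (coenvelope P).IsClosedUnderIsomorphisms :=
  (coenvelope_isCoenvelopeClosed P).prod.isClosedUnderIsomorphisms

/-- The recursive construction of a compatible sequence. -/
lemma exists_seq {α : ℕ → Type*} (a : α 0) (s : ∀ i, α i → α (i + 1)) :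
    ∃ x : ∀ i, α i, x 0 = a ∧ ∀ i, x (i + 1) = s i (x i) :=
  ⟨fun i => Nat.rec a s i, rfl, fun _ => rfl⟩

/-- In a homotopy limit diagram, compatible families lift. -/
lemma IsHomotopyLimit.data {Y : ℕ → C} {φ : ∀ i, Y (i + 1) ⟶ Y i} {X : C}
    {c : Fan Y} (hc : IsLimit c) {f : X ⟶ c.pt} {d : c.pt ⟶ c.pt} {h : c.pt ⟶ X⟦(1 : ℤ)⟧}
    (hd : ∀ i, d ≫ c.proj i = c.proj i - c.proj (i + 1) ≫ φ i)
    (hT : Triangle.mk f d h ∈ distTriang C) :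
    (∀ i, (f ≫ c.proj (i + 1)) ≫ φ i = f ≫ c.proj i) ∧
    ∀ {W : C} (x : ∀ i, W ⟶ Y i), (∀ i, x (i + 1) ≫ φ i = x i) →
      ∃ l : W ⟶ X, ∀ i, l ≫ f ≫ c.proj i = x i := by
  constructor
  · intro i
    have h1 : f ≫ d = 0 := comp_distTriang_mor_zero₁₂ _ hT
    have h2 : (f ≫ d) ≫ c.proj i = 0 := by rw [h1, zero_comp]
    rw [Category.assoc, hd, Preadditive.comp_sub, sub_eq_zero] at h2
    rw [Category.assoc, ← h2]
  · intro W x hx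
    obtain ⟨k, hk⟩ := exists_fan_lift hc x
    obtain ⟨l, hl⟩ := exists_fiber_factor hT k (by
      refine fan_hom_ext hc fun i => ?_
      rw [Category.assoc, hd, Preadditive.comp_sub, hk, ← Category.assoc, hk, hx]
      simp)
    exact ⟨l, fun i => by rw [← Category.assoc, hl, hk]⟩

/-- The homotopy limit of `⋯ ⟶ B ⟶ B ⟶ D`, where all transition maps but the last one are
identities, is `B`. -/
lemma isHomotopyLimit_of_eventually_constant [HasProductsOfShape ℕ C] {B D : C} (p : B ⟶ D) :
    ∃ (Y : ℕ → C) (φ : ∀ i, Y (i + 1) ⟶ Y i), Y 0 = D ∧ (∀ i, Y (i + 1) = B) ∧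
      (Nonempty (Arrow.mk (φ 0) ≅ Arrow.mk p)) ∧ (∀ i, IsIso (φ (i + 1))) ∧
      IsHomotopyLimit Y φ B := by
  let Y : ℕ → C := fun i => Nat.casesOn i D (fun _ => B)
  let φ : ∀ i, Y (i + 1) ⟶ Y i := fun i => Nat.casesOn i p (fun _ => 𝟙 B)
  refine ⟨Y, φ, rfl, fun _ => rfl, ⟨Iso.refl _⟩, fun i => inferInstanceAs (IsIso (𝟙 B)), ?_⟩
  let c : Fan Y := limit.cone (Discrete.functor Y)
  have hc : IsLimit c := limit.isLimit (Discrete.functor Y)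
  obtain ⟨d, hd⟩ := exists_id_sub_shift φ hc
  let q0 : c.pt ⟶ D := c.proj 0
  let q : ℕ → (c.pt ⟶ B) := fun j => c.proj (j + 1)
  have hext {T : C} {f g : T ⟶ c.pt} (h0 : f ≫ q0 = g ≫ q0) (h : ∀ j, f ≫ q j = g ≫ q j) :
      f = g := fan_hom_ext hc fun i => by
    cases i with
    | zero => exact h0
    | succ j => exact h j
  have hlift {T : C} (a : T ⟶ D) (b : ℕ → (T ⟶ B)) :
      ∃ g : T ⟶ c.pt, g ≫ q0 = a ∧ ∀ j, g ≫ q j = b j := by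
    obtain ⟨g, hg⟩ := exists_fan_lift hc (fun i => (Nat.casesOn i a b : T ⟶ Y i))
    exact ⟨g, hg 0, fun j => hg (j + 1)⟩
  have hd0 : d ≫ q0 = q0 - q 0 ≫ p := hd 0
  have hd1 (j : ℕ) : d ≫ q j = q j - q (j + 1) :=
    (hd (j + 1)).trans (congrArg (fun f : c.pt ⟶ B => q j - f) (Category.comp_id (q (j + 1))))
  obtain ⟨k, hk0, hk⟩ := hlift p (fun _ => 𝟙 B)
  -- A section `s` of `d` must satisfy `x j - x (j + 1) = q j`. The initial value 0 removes the
  -- contribution of `p` in the coordinate `D`.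
  obtain ⟨x, hx0, hx⟩ := exists_seq (α := fun _ => (c.pt ⟶ B)) 0 (fun j y => y - q j)
  obtain ⟨s, hs0, hs⟩ := hlift q0 x
  have key (j : ℕ) : q 0 + d ≫ x j = q j := by
    induction j with
    | zero => simp [hx0]
    | succ j ih =>
      rw [hx, Preadditive.comp_sub, hd1, ← add_sub_assoc, ih]
      abel
  refine ⟨c, hc, k, d, 0, hd, split_distinguished (l := q 0) (s := s) (hk 0) ?_ ?_ ?_⟩
  · refine hext ?_ fun j => ?_
    · rw [Category.id_comp, Category.assoc, hd0, Preadditive.comp_sub, hs0, ← Category.assoc, hs,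
        hx0, zero_comp, sub_zero]
    · rw [Category.id_comp, Category.assoc, hd1, Preadditive.comp_sub, hs, hs, hx]
      abel
  · refine hext ?_ fun j => ?_
    · rw [Category.assoc, hd0, Preadditive.comp_sub, hk0, ← Category.assoc, hk]
      simp
    · rw [Category.assoc, hd1, Preadditive.comp_sub, hk, hk]
      simp
  · refine hext ?_ fun j => ?_
    · rw [Preadditive.add_comp, Category.assoc, Category.assoc, hk0, hs0, hd0, Category.id_comp]
      abel
    · rw [Preadditive.add_comp, Category.assoc, Category.assoc, hk, hs, Category.comp_id, key,
        Category.id_comp]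

namespace IsCoenvelopeClosed

variable {Q : ObjectProperty C}

lemma isClosedUnderIsomorphisms (hQ : IsCoenvelopeClosed Q) : Q.IsClosedUnderIsomorphisms :=
  hQ.prod.isClosedUnderIsomorphisms

/-- A fibre is a cone shifted by `-1`; this form matches the triangles that the octahedral axiom
yields. -/
lemma holim_of_fibers (hQ : IsCoenvelopeClosed Q) {Y : ℕ → C} {φ : ∀ i, Y (i + 1) ⟶ Y i}
    (h0 : Q (Y 0))
    (h : ∀ i, ∃ (Z : C) (g : Z ⟶ Y (i + 1)) (k : Y i ⟶ Z⟦(1 : ℤ)⟧),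
      Triangle.mk g (φ i) k ∈ distTriang C ∧ Q Z) {X : C} (hX : IsHomotopyLimit Y φ X) : Q X := by
  have := hQ.isClosedUnderIsomorphisms
  refine hQ.holim Y φ h0 (fun i => ?_) X hX
  obtain ⟨Z, g, k, hT, hZ⟩ := h i
  exact ⟨_, _, _, rot_of_distTriang _ hT, Q.prop_of_iso (shiftShiftNeg Z (1 : ℤ)).symm hZ⟩

/-- The middle term `B` of a triangle `A ⟶ B ⟶ D` is the homotopy limit of `⋯ = B = B ⟶ D`, whose
first fibre is `A` and whose other fibres vanish. -/
lemma ext [HasProductsOfShape ℕ C] (hQ : IsCoenvelopeClosed Q) (T : Triangle C)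
    (hT : T ∈ distTriang C) (h1 : Q T.obj₁) (h3 : Q T.obj₃) : Q T.obj₂ := by
  have := hQ.isClosedUnderIsomorphisms
  obtain ⟨Y, φ, hY0, hY, ⟨e⟩, hφ, hX⟩ := isHomotopyLimit_of_eventually_constant T.mor₂
  refine hQ.holim_of_fibers (by rwa [hY0]) (fun i => ?_) hX
  cases i with
  | zero =>
    obtain ⟨Z, g, k, hT'⟩ := distinguished_cocone_triangle₁ (φ 0)
    obtain ⟨e', -⟩ := exists_iso_of_arrow_iso _ _ (rot_of_distTriang _ hT')
      (rot_of_distTriang _ hT) e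
    exact ⟨Z, g, k, hT', Q.prop_of_iso
      ((shiftEquiv C (1 : ℤ)).functor.preimageIso (Triangle.π₃.mapIso e')).symm h1⟩
  | succ j =>
    have := hφ j
    obtain ⟨Z, g, k, hT'⟩ := distinguished_cocone_triangle₁ (φ (j + 1))
    exact ⟨Z, g, k, hT', hQ.zero _ (Triangle.isZero₁_of_isIso₂ _ hT' (hφ j))⟩

lemma isStableUnderRetracts [HasProductsOfShape ℕ C] (hQ : IsCoenvelopeClosed Q)
    (hshift : ∀ A, Q A → Q (A⟦(1 : ℤ)⟧)) : Q.IsStableUnderRetracts := by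
  have := hQ.isClosedUnderIsomorphisms
  have := hQ.prod.nat
  exact isStableUnderRetracts_of_extensions (fun A hA => Q.prop_pi _ fun _ => hA) hshift
    (fun T hT h1 h3 => hQ.ext T hT h1 h3)

end IsCoenvelopeClosed

/-- The shift of a distinguished triangle, with the sign moved to the last morphism. -/
lemma shift_distinguished_mk {X Y Z : C} {f : X ⟶ Y} {g : Y ⟶ Z} {h : Z ⟶ X⟦(1 : ℤ)⟧}
    (hT : Triangle.mk f g h ∈ distTriang C) (n : ℤ) :
    ∃ k : Z⟦n⟧ ⟶ X⟦n⟧⟦(1 : ℤ)⟧, Triangle.mk (f⟦n⟧') (g⟦n⟧') k ∈ distTriang C := by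
  have h1 := Triangle.shift_distinguished _ hT n
  let T' := (CategoryTheory.shiftFunctor (Triangle C) n).obj (Triangle.mk f g h)
  let e : Z⟦n⟧ ≅ Z⟦n⟧ := Iso.refl _
  let ε : ℤˣ := n.negOnePow
  have hε : (ε : ℤ) * ε = 1 := congrArg Units.val (Int.units_mul_self ε)
  -- Acting by the sign on the middle object alone cancels it in the first two morphisms and leaves
  -- the third unchanged.
  let b : Y⟦n⟧ ≅ Y⟦n⟧ := ⟨(ε : ℤ) • 𝟙 _, (ε : ℤ) • 𝟙 _, by simp [smul_smul, hε],
    by simp [smul_smul, hε]⟩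
  refine ⟨T'.mor₃, isomorphic_distinguished _ h1 _
    (Triangle.isoMk _ _ (Iso.refl _) b (Iso.refl _) ?_ ?_ ?_)⟩
  · change f⟦n⟧' ≫ ((ε : ℤ) • 𝟙 _) = 𝟙 _ ≫ (n.negOnePow • f⟦n⟧')
    rw [Preadditive.comp_zsmul]
    simp [ε, Units.smul_def]
  · change g⟦n⟧' ≫ 𝟙 _ = ((ε : ℤ) • 𝟙 _) ≫ (n.negOnePow • g⟦n⟧')
    rw [Preadditive.zsmul_comp, Units.smul_def, Preadditive.comp_zsmul, smul_smul, hε]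
    simp
  · change T'.mor₃ ≫ (𝟙 _)⟦(1 : ℤ)⟧' = 𝟙 _ ≫ T'.mor₃
    simp

lemma IsHomotopyLimit.shift {Y : ℕ → C} {φ : ∀ i, Y (i + 1) ⟶ Y i} {X : C}
    (hX : IsHomotopyLimit Y φ X) (n : ℤ) :
    IsHomotopyLimit (fun i => (Y i)⟦n⟧) (fun i => (φ i)⟦n⟧') (X⟦n⟧) := by
  obtain ⟨c, hc, f, d, h, hd, hT⟩ := hX
  obtain ⟨k, hk⟩ := shift_distinguished_mk hT n
  obtain ⟨hc'⟩ := nonempty_isLimit_map_fan (shiftFunctor C n) hc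
  refine ⟨_, hc', f⟦n⟧', d⟦n⟧', k, fun i => ?_, hk⟩
  change d⟦n⟧' ≫ (c.proj i)⟦n⟧' = (c.proj i)⟦n⟧' - (c.proj (i + 1))⟦n⟧' ≫ (φ i)⟦n⟧'
  rw [← Functor.map_comp, ← Functor.map_comp, ← Functor.map_sub, hd]

lemma IsCoenvelopeClosed.shift {Q : ObjectProperty C} (hQ : IsCoenvelopeClosed Q) (n : ℤ) :
    IsCoenvelopeClosed (Q.shift n) where
  zero X hX := hQ.zero _ ((shiftFunctor C n).map_isZero hX)
  prod := .of_fan fun _ _ _ hc h => by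
    obtain ⟨hc'⟩ := nonempty_isLimit_map_fan (shiftFunctor C n) hc
    exact hQ.prod.fan hc' h
  holim Y φ h0 h X hX := by
    have := hQ.isClosedUnderIsomorphisms
    refine hQ.holim (fun i => (Y i)⟦n⟧) (fun i => (φ i)⟦n⟧') h0 (fun i => ?_) _ (hX.shift n)
    obtain ⟨Z, g, k, hT, hZ⟩ := h i
    obtain ⟨k', hT'⟩ := shift_distinguished_mk hT n
    exact ⟨_, _, _, hT', Q.prop_of_iso (shiftComm Z (-1) n) hZ⟩

/-- Minimality of the coenvelope, applied to a shifted coenvelope, reduces the claim to generators.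
-/
lemma coenvelope_shift {P P' : ObjectProperty C} {n : ℤ} (h : ∀ X, P X → coenvelope P' (X⟦n⟧))
    {X : C} (hX : coenvelope P X) : coenvelope P' (X⟦n⟧) :=
  hX _ ((coenvelope_isCoenvelopeClosed P').shift n) h

lemma coenvelope_translate (P : ObjectProperty C) (n : ℤ) :
    coenvelope (translate P n) = translate (coenvelope P) n := by
  ext X
  rw [translate_iff]
  constructor
  · refine fun hX => coenvelope_shift ?_ hX
    rintro Z ⟨Y, hY, ⟨e⟩⟩
    exact (coenvelope P).prop_of_iso
      ((shiftShiftNeg Y n).symm ≪≫ (shiftFunctor C (-n)).mapIso e) (le_coenvelope _ _ hY)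
  · intro hX
    refine (coenvelope _).prop_of_iso (shiftNegShift X n)
      (coenvelope_shift (P' := translate P n) (fun Z hZ => ?_) hX)
    exact le_coenvelope _ _ ⟨Z, hZ, ⟨Iso.refl _⟩⟩

end Coenvelope

/-! ### Cocompact objects and morphisms out of products. -/

section Cocompact

variable {C : Type u} [Category.{v} C] [Preadditive C]

/-- Every morphism from a small product to `X` is a finite sum of morphisms that factor through
projections. -/
def FactorsFinitely (X : C) : Prop :=
  ∀ (I : Type v) (Y : I → C) (c : Fan Y), IsLimit c → ∀ g : c.pt ⟶ X,
    g ∈ AddSubgroup.closure {f | ∃ (i : I) (y : Y i ⟶ X), f = c.proj i ≫ y}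

lemma IsCocompact.factorsFinitely {X : C} (hX : IsCocompact X) : FactorsFinitely X := by
  classical
  intro I Y c hc g
  obtain ⟨x, rfl⟩ := (hX I Y c hc).2 g
  induction x using DirectSum.induction_on with
  | zero => rw [map_zero]; exact zero_mem _
  | of i y =>
    refine AddSubgroup.subset_closure ⟨i, y, ?_⟩
    simp only [cocompactComparison, DirectSum.toAddMonoid_of]
    rfl
  | add x y hx hy => rw [map_add]; exact add_mem hx hy

-- This is the form of cocompactness used below. It carries the whole content: injectivity of the
-- comparison map is automatic, as the coordinate inclusions recover the components.
namespace FactorsFinitely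

variable {X : C}

lemma of_iso (hX : FactorsFinitely X) {X' : C} (e : X ≅ X') : FactorsFinitely X' := by
  intro I Y c hc g
  have h := hX I Y c hc (g ≫ e.inv)
  have h2 := AddSubgroup.mem_map_of_mem (Preadditive.rightComp c.pt e.hom) h
  rw [AddMonoidHom.map_closure] at h2
  have h3 : Preadditive.rightComp c.pt e.hom (g ≫ e.inv) = g := by
    simp [Preadditive.rightComp]
  rw [h3] at h2
  refine AddSubgroup.closure_mono ?_ h2
  rintro _ ⟨_, ⟨i, y, rfl⟩, rfl⟩
  exact ⟨i, y ≫ e.hom, by simp [Preadditive.rightComp]⟩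

/-- Shifts preserve products, so a morphism from a product to `X⟦n⟧` corresponds to one from the
product of the `(Y i)⟦-n⟧` to `X`. -/
lemma shift [HasShift C ℤ] [∀ n : ℤ, (shiftFunctor C n).Additive] (hX : FactorsFinitely X)
    (n : ℤ) : FactorsFinitely (X⟦n⟧) := by
  intro I Y c hc g
  obtain ⟨hc'⟩ := nonempty_isLimit_map_fan (shiftFunctor C (-n)) hc
  obtain ⟨u, hu⟩ := (shiftFunctor C n).map_surjective ((shiftNegShift c.pt n).hom ≫ g)
  have h := hX I _ _ hc' u
  let Ψ : (c.pt⟦-n⟧ ⟶ X) →+ (c.pt ⟶ X⟦n⟧) :=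
    (Preadditive.leftComp _ (shiftNegShift c.pt n).inv).comp (shiftFunctor C n).mapAddHom
  have h2 := AddSubgroup.mem_map_of_mem Ψ h
  rw [AddMonoidHom.map_closure] at h2
  have h3 : Ψ u = g := by
    change (shiftNegShift c.pt n).inv ≫ (shiftFunctor C n).map u = g
    rw [hu, Iso.inv_hom_id_assoc]
  rw [h3] at h2
  refine AddSubgroup.closure_mono ?_ h2
  rintro _ ⟨_, ⟨i, y, rfl⟩, rfl⟩
  refine ⟨i, (shiftNegShift (Y i) n).inv ≫ y⟦n⟧', ?_⟩
  change (shiftNegShift c.pt n).inv ≫ ((c.proj i)⟦-n⟧' ≫ y)⟦n⟧' = _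
  rw [Functor.map_comp, ← Category.assoc, ← Category.assoc]
  congr 1
  exact ((shiftEquiv C n).counitIso.inv.naturality (c.proj i)).symm

lemma eq_zero (hX : FactorsFinitely X) {I : Type v} {Y : I → C} {c : Fan Y} (hc : IsLimit c)
    (h : ∀ i (y : Y i ⟶ X), y = 0) (g : c.pt ⟶ X) : g = 0 := by
  refine AddSubgroup.closure_induction ?_ rfl ?_ ?_ (hX I Y c hc g)
  · rintro _ ⟨i, y, rfl⟩
    rw [h i y, comp_zero]
  · rintro _ _ _ _ rfl rfl
    exact add_zero 0
  · rintro _ _ rfl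
    exact neg_zero

lemma nat (hX : FactorsFinitely X) {Y : ℕ → C} {c : Fan Y} (hc : IsLimit c) (g : c.pt ⟶ X) :
    g ∈ AddSubgroup.closure {f | ∃ (i : ℕ) (y : Y i ⟶ X), f = c.proj i ≫ y} := by
  have h := hX (ULift.{v} ℕ) (fun i => Y i.down) (Fan.mk c.pt fun i => c.proj i.down)
    (Fan.IsLimit.mk _ (fun s => Fan.IsLimit.lift hc fun i => s.proj ⟨i⟩)
      (fun s i => Fan.IsLimit.fac hc _ _)
      (fun s m hm => fan_hom_ext hc fun i => (hm ⟨i⟩).trans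
        (Fan.IsLimit.fac hc (fun i => s.proj ⟨i⟩) i).symm)) g
  refine AddSubgroup.closure_mono ?_ h
  rintro _ ⟨i, y, rfl⟩
  exact ⟨i.down, y, rfl⟩

/-- A finite sum of morphisms through projections depends on finitely many coordinates only. -/
lemma exists_bound (hX : FactorsFinitely X) {Y : ℕ → C} {c : Fan Y} (hc : IsLimit c)
    (g : c.pt ⟶ X) :
    ∃ N : ℕ, ∀ a : c.pt ⟶ c.pt, (∀ i < N, a ≫ c.proj i = 0) → a ≫ g = 0 := by
  refine AddSubgroup.closure_induction ?_ ⟨0, fun a _ => comp_zero⟩ ?_ ?_ (hX.nat hc g)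
  · rintro _ ⟨i, y, rfl⟩
    exact ⟨i + 1, fun a ha => by rw [← Category.assoc, ha i (Nat.lt_succ_self i), zero_comp]⟩
  · rintro x y _ _ ⟨N, hN⟩ ⟨N', hN'⟩
    refine ⟨max N N', fun a ha => ?_⟩
    rw [Preadditive.comp_add, hN a fun i hi => ha i (lt_max_of_lt_left hi),
      hN' a fun i hi => ha i (lt_max_of_lt_right hi), add_zero]
  · rintro x _ ⟨N, hN⟩
    exact ⟨N, fun a ha => by rw [Preadditive.comp_neg, hN a ha, neg_zero]⟩

/-- Precomposition with the identity minus the shift is injective on morphisms to `X`. -/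
lemma eq_zero_of_id_sub_shift (hX : FactorsFinitely X) {Y : ℕ → C} {φ : ∀ i, Y (i + 1) ⟶ Y i}
    {c : Fan Y} (hc : IsLimit c) {d : c.pt ⟶ c.pt}
    (hd : ∀ i, d ≫ c.proj i = c.proj i - c.proj (i + 1) ≫ φ i) {g : c.pt ⟶ X}
    (hg : d ≫ g = 0) : g = 0 := by
  classical
  choose ι hι using fun j => exists_fan_lift hc
    (fun i => if h : j = i then eqToHom (congrArg Y h) else 0)
  have hι1 (j : ℕ) : ι j ≫ c.proj j = 𝟙 _ := by rw [hι]; simp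
  have hι2 {i j : ℕ} (h : j ≠ i) : ι j ≫ c.proj i = 0 := by rw [hι, dif_neg h]
  have h0 : ι 0 ≫ d = ι 0 := fan_hom_ext hc fun i => by
    rw [Category.assoc, hd, Preadditive.comp_sub, ← Category.assoc (ι 0) _ (φ i),
      hι2 (Nat.succ_ne_zero i).symm, zero_comp, sub_zero]
  -- With `d ≫ g = 0`, this recursion and `h0` force `g` to vanish on every coordinate inclusion.
  have h1 (j : ℕ) : ι (j + 1) ≫ d = ι (j + 1) - φ j ≫ ι j := fan_hom_ext hc fun i => by
    rw [Category.assoc, hd, Preadditive.comp_sub, Preadditive.sub_comp, Category.assoc,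
      ← Category.assoc _ _ (φ i)]
    congr 1
    by_cases h : j = i
    · subst h
      rw [hι1, hι1, Category.id_comp, Category.comp_id]
    · rw [hι2 h, hι2 (fun h' => h (Nat.succ_injective h')), zero_comp, comp_zero]
  have h2 (j : ℕ) : ι j ≫ g = 0 := by
    induction j with
    | zero => rw [← h0, Category.assoc, hg, comp_zero]
    | succ j ih =>
      have : (ι (j + 1) ≫ d) ≫ g = 0 := by rw [Category.assoc, hg, comp_zero]
      rw [h1, Preadditive.sub_comp, Category.assoc, ih, comp_zero, sub_zero] at this
      exact this
  obtain ⟨N, hN⟩ := hX.exists_bound hc g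
  -- The identity minus the projector onto the first `N` coordinates is invisible to `g`, and so is
  -- that projector by `h2`.
  have h3 := hN (𝟙 _ - ∑ j ∈ Finset.range N, c.proj j ≫ ι j) (fun i hi => by
    rw [Preadditive.sub_comp, Preadditive.sum_comp, Finset.sum_eq_single i]
    · rw [Category.assoc, hι1, Category.id_comp, Category.comp_id, sub_self]
    · intro j _ hj
      rw [Category.assoc, hι2 hj, comp_zero]
    · intro h
      exact absurd (Finset.mem_range.mpr hi) h)
  rw [Preadditive.sub_comp, Category.id_comp, Preadditive.sum_comp, Finset.sum_eq_zero,
    sub_zero] at h3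
  · exact h3
  · intro j _
    rw [Category.assoc, h2, comp_zero]

end FactorsFinitely

end Cocompact

/-! ### Construction of the orthogonal decomposition. -/

section Decomposition

variable {C : Type u} [Category.{v} C] [Preadditive C] [HasZeroObject C] [HasShift C ℤ]
  [∀ n : ℤ, (shiftFunctor C n).Additive] [Pretriangulated C]

lemma exists_extension {X Y Z W : C} {f : X ⟶ Y} {g : Y ⟶ Z} {h : Z ⟶ X⟦(1 : ℤ)⟧}
    (hT : Triangle.mk f g h ∈ distTriang C) (k : X ⟶ W) (hk : h ≫ k⟦(1 : ℤ)⟧' = 0) :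
    ∃ l : Y ⟶ W, f ≫ l = k := by
  obtain ⟨l, hl⟩ : ∃ l : Y⟦(1 : ℤ)⟧ ⟶ W⟦(1 : ℤ)⟧, k⟦(1 : ℤ)⟧' = (-(f⟦(1 : ℤ)⟧')) ≫ l :=
    Triangle.yoneda_exact₂ _ (rot_of_distTriang _ (rot_of_distTriang _ hT)) (k⟦(1 : ℤ)⟧') hk
  obtain ⟨l, rfl⟩ := (shiftFunctor C (1 : ℤ)).map_surjective l
  refine ⟨-l, (shiftFunctor C (1 : ℤ)).map_injective ?_⟩
  rw [hl]
  simp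

/-- A morphism from a homotopy limit to a cocompact object factors through some term of the
sequence. -/
lemma exists_holim_factor {Y : ℕ → C} {φ : ∀ i, Y (i + 1) ⟶ Y i} {X : C}
    {c : Fan Y} (hc : IsLimit c) {f : X ⟶ c.pt} {d : c.pt ⟶ c.pt} {h : c.pt ⟶ X⟦(1 : ℤ)⟧}
    (hd : ∀ i, d ≫ c.proj i = c.proj i - c.proj (i + 1) ≫ φ i)
    (hT : Triangle.mk f d h ∈ distTriang C) {W : C} (hW : FactorsFinitely W) (g : X ⟶ W) :
    ∃ (i : ℕ) (y : Y i ⟶ W), f ≫ c.proj i ≫ y = g := by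
  have hcomp := (IsHomotopyLimit.data hc hd hT).1
  have h0 : d ≫ h = 0 := comp_distTriang_mor_zero₂₃ _ hT
  -- The obstruction to extending `g` over the product is a morphism to `W⟦1⟧` killed by `d`, hence
  -- zero.
  obtain ⟨l, rfl⟩ := exists_extension hT g
    ((hW.shift 1).eq_zero_of_id_sub_shift hc hd (by rw [← Category.assoc, h0, zero_comp]))
  -- Factorizations can be moved to later terms, so the finitely many summands of `l` meet at one
  -- index.
  have hup (i j : ℕ) (y : Y i ⟶ W) :
      ∃ y' : Y (i + j) ⟶ W, f ≫ c.proj (i + j) ≫ y' = f ≫ c.proj i ≫ y := by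
    induction j with
    | zero => exact ⟨y, rfl⟩
    | succ j ih =>
      obtain ⟨y', hy'⟩ := ih
      refine ⟨φ (i + j) ≫ y', ?_⟩
      rw [← hy', ← Category.assoc f (c.proj (i + j)), ← hcomp, Category.assoc, Category.assoc]
      rfl
  refine AddSubgroup.closure_induction ?_ ⟨0, 0, by simp⟩ ?_ ?_ (hW.nat hc l)
  · rintro _ ⟨i, y, rfl⟩
    exact ⟨i, y, rfl⟩
  · rintro x x' _ _ ⟨i, y, hy⟩ ⟨i', y', hy'⟩
    obtain ⟨z, hz⟩ := hup i i' y
    obtain ⟨z', hz'⟩ := hup i' i y'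
    obtain ⟨z'', hz''⟩ : ∃ z'' : Y (i + i') ⟶ W, f ≫ c.proj (i + i') ≫ z'' =
        f ≫ c.proj (i' + i) ≫ z' := by
      rw [add_comm i i']
      exact ⟨z', rfl⟩
    refine ⟨i + i', z + z'', ?_⟩
    rw [Preadditive.comp_add, Preadditive.comp_add, Preadditive.comp_add, hz, hz'', hz', hy, hy']
  · rintro x _ ⟨i, y, hy⟩
    exact ⟨i, -y, by simp [hy]⟩

/-- A factorization datum `L ⟶ M ⟶ A ⟶ L⟦1⟧`. -/
structure Stage (M : C) where
  L : C
  A : C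
  l : L ⟶ M
  a : M ⟶ A
  k : A ⟶ L⟦(1 : ℤ)⟧
  dist : Triangle.mk l a k ∈ distTriang C

variable [HasProducts.{v} C]

/-- For an essentially small class `P`, every object has a left approximation by a product of
objects of `P`. -/
lemma exists_left_approximation (P : ObjectProperty C) [ObjectProperty.EssentiallySmall.{v} P]
    (L : C) : ∃ (P₀ : C) (p : L ⟶ P₀), coenvelope P P₀ ∧
      ∀ X, P X → ∀ g : L ⟶ X, ∃ g' : P₀ ⟶ X, p ≫ g' = g := by
  obtain ⟨P', hP', hle, hiso⟩ := ObjectProperty.EssentiallySmall.exists_small_le.{v} P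
  let I := Shrink.{v} (Subtype P')
  let σ : I → C := fun i => ((equivShrink (Subtype P')).symm i).1
  -- One factor for each morphism from `L` to a representative; the tautological map to the product
  -- is the approximation.
  let J := Σ i : I, (L ⟶ σ i)
  refine ⟨∏ᶜ fun j : J => σ j.1, Pi.lift fun j => j.2, ?_, ?_⟩
  · exact (coenvelope_isCoenvelopeClosed P).prod.pi _ fun j =>
      le_coenvelope _ _ (hle _ ((equivShrink (Subtype P')).symm j.1).2)
  · intro X hX g
    obtain ⟨X', hX', ⟨e⟩⟩ := hiso X hX
    have hi : σ (equivShrink _ ⟨X', hX'⟩) = X' := by simp [σ]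
    refine ⟨Pi.π (fun j : J => σ j.1) ⟨equivShrink _ ⟨X', hX'⟩, g ≫ e.hom ≫ eqToHom hi.symm⟩ ≫
      eqToHom hi ≫ e.inv, ?_⟩
    simp

/-- `L'` is the fibre of an approximation `L ⟶ P₀`, so `L' ⟶ L` kills all morphisms from `L` to `P`.
The octahedron on `L' ⟶ L ⟶ M` identifies the fibre of `A' ⟶ A` with `P₀`. -/
lemma Stage.exists_next [IsTriangulated C] (P : ObjectProperty C)
    [ObjectProperty.EssentiallySmall.{v} P] {M : C} (T : Stage M) :
    ∃ (T' : Stage M) (φ : T'.A ⟶ T.A) (i : T'.L ⟶ T.L),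
      T'.a ≫ φ = T.a ∧ T'.k ≫ i⟦(1 : ℤ)⟧' = φ ≫ T.k ∧ i ≫ T.l = T'.l ∧
      (∀ X, P X → ∀ g : T.L ⟶ X, i ≫ g = 0) ∧
      ∃ (Z : C) (g : Z ⟶ T'.A) (k : T.A ⟶ Z⟦(1 : ℤ)⟧),
        Triangle.mk g φ k ∈ distTriang C ∧ coenvelope P Z := by
  obtain ⟨P₀, p, hP₀, hp⟩ := exists_left_approximation P T.L
  obtain ⟨L', i, q, h₁⟩ := distinguished_cocone_triangle₁ p
  obtain ⟨A', a', k', h₂⟩ := distinguished_cocone_triangle (i ≫ T.l)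
  let o := Triangulated.someOctahedron rfl h₁ T.dist h₂
  refine ⟨⟨L', A', i ≫ T.l, a', k', h₂⟩, o.m₃, i, o.comm₃, o.comm₄, rfl, ?_, P₀, o.m₁, _,
    o.mem, hP₀⟩
  intro X hX g
  obtain ⟨g', rfl⟩ := hp X hX g
  have h0 : i ≫ p = 0 := comp_distTriang_mor_zero₁₂ _ h₁
  rw [← Category.assoc, h0, zero_comp]

open ZeroObject in
/-- Every object `M` is an extension of an object of the coenvelope of `P` by an object of the
left orthogonal of `P`, for an essentially small class `P` of cocompact objects. -/
theorem exists_orthogonal_decomposition [IsTriangulated C] (P : ObjectProperty C)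
    [ObjectProperty.EssentiallySmall.{v} P] (hP : ∀ X, P X → FactorsFinitely X) (M : C) :
    ∃ (L A : C) (b : L ⟶ M) (a : M ⟶ A) (f : A ⟶ L⟦(1 : ℤ)⟧),
      Triangle.mk b a f ∈ distTriang C ∧ P.leftOrthogonal L ∧ coenvelope P A := by
  have : HasProducts.{0} C := has_smallest_products_of_hasProducts.{v}
  choose next φ ι ha hk hl hkill Z g k hdist hZ using Stage.exists_next (C := C) P (M := M)
  let T : ℕ → Stage M := fun n => Nat.rec ⟨M, 0, 𝟙 M, 0, 0, contractible_distinguished M⟩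
    (fun _ => next) n
  let c : Fan fun n => (T n).A := limit.cone (Discrete.functor _)
  have hc : IsLimit c := limit.isLimit (Discrete.functor _)
  obtain ⟨d, hd⟩ := exists_id_sub_shift (fun n => φ (T n)) hc
  obtain ⟨A, f, h, hT⟩ := distinguished_cocone_triangle₁ d
  have hA : coenvelope P A := (coenvelope_isCoenvelopeClosed P).holim_of_fibers
    ((coenvelope_isCoenvelopeClosed P).zero _ (isZero_zero C))
    (fun n => ⟨_, _, _, hdist (T n), hZ (T n)⟩) ⟨c, hc, f, d, h, hd, hT⟩
  obtain ⟨hcomp, hlift⟩ := IsHomotopyLimit.data hc hd hT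
  obtain ⟨a, hfa⟩ := hlift (fun n => (T n).a) (fun n => ha (T n))
  obtain ⟨L, b, δ, hL⟩ := distinguished_cocone_triangle₁ a
  refine ⟨L, A, b, a, δ, hL, ?_, hA⟩
  -- Stage 0 has `L = M`, so the first step already kills `u` on `(T 1).L` and `u` factors through
  -- `(T 1).A`.
  have surj (X : C) (hX : P X) (u : M ⟶ X) : ∃ u' : A ⟶ X, a ≫ u' = u := by
    obtain ⟨u', hu'⟩ := exists_cone_factor (T 1).dist u (by
      rw [show (T 1).l = (next (T 0)).l from rfl, ← hl]
      exact hkill (T 0) X hX (𝟙 M ≫ u) |> (by simpa [T] using ·))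
    refine ⟨f ≫ c.proj 1 ≫ u', ?_⟩
    rw [← hu', ← hfa 1]
    simp
  -- `u` factors through some stage `n`; vanishing on `M`, it then comes from a morphism `(T n).L ⟶
  -- X`, which the next stage kills.
  have inj (X : C) (hX : P X) (u : A ⟶ X⟦(1 : ℤ)⟧) (hu : a ≫ u = 0) : u = 0 := by
    obtain ⟨n, y, rfl⟩ := exists_holim_factor hc hd hT ((hP X hX).shift 1) u
    obtain ⟨w, rfl⟩ := exists_connecting_factor (T n).dist y
      (by rw [← hu, ← Category.assoc f, ← Category.assoc a, hfa])
    obtain ⟨w, rfl⟩ := (shiftFunctor C (1 : ℤ)).map_surjective w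
    have h0 : φ (T n) ≫ (T n).k ≫ w⟦(1 : ℤ)⟧' = 0 := by
      rw [← Category.assoc, ← hk, Category.assoc, ← Functor.map_comp, hkill _ X hX w,
        Functor.map_zero, comp_zero]
    rw [← Category.assoc f, ← hcomp n, Category.assoc]
    exact (congrArg (fun t => (f ≫ c.proj (n + 1)) ≫ t) h0).trans comp_zero
  -- In the long exact sequence of `Hom(-, X)`, `inj` extends `u` to `M` and `surj` then extends it
  -- to `A`, so `u` is zero.
  intro X u hX
  have h0 : a ≫ δ = 0 := comp_distTriang_mor_zero₂₃ _ hL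
  obtain ⟨u', rfl⟩ := exists_extension hL u
    (inj X hX _ (by rw [← Category.assoc, h0, zero_comp]))
  obtain ⟨u'', rfl⟩ := surj X hX u'
  have h1 : b ≫ a = 0 := comp_distTriang_mor_zero₁₂ _ hL
  rw [← Category.assoc, h1, zero_comp]

end Decomposition

/-! ### The classes `classOne`, `coenvelope`, `cogen` and `perp`. -/

section Classes

variable {C : Type u} [Category.{v} C] [Preadditive C] [HasZeroObject C] [HasShift C ℤ]
  [∀ n : ℤ, (shiftFunctor C n).Additive] [Pretriangulated C]

instance leftOrthogonal_isStableUnderRetracts (P : ObjectProperty C) :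
    P.leftOrthogonal.IsStableUnderRetracts where
  of_retract {X Y} ρ hY Z f hZ := by
    rw [← Category.id_comp f, ← ρ.retract, Category.assoc, hY (ρ.r ≫ f) hZ, comp_zero]

lemma rightOrthogonal_closedUnderSmallProducts (P : ObjectProperty C) :
    ClosedUnderSmallProducts P.rightOrthogonal :=
  .of_fan fun _ _ _ hc h _ f hX => fan_hom_ext hc fun i => by
    rw [h i (f ≫ _) hX, zero_comp]

lemma leftOrthogonal_closedUnderSmallProducts {P : ObjectProperty C}
    (hP : ∀ X, P X → FactorsFinitely X) : ClosedUnderSmallProducts P.leftOrthogonal :=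
  .of_fan fun _ _ _ hc h X f hX => (hP X hX).eq_zero hc (fun i y => h i y hX) f

/-- The class of objects `Y` such that `Y⟦1⟧` is right orthogonal to `R` satisfies the closure
properties of coenvelopes. -/
lemma rightOrthogonal_shift_isCoenvelopeClosed (R : ObjectProperty C) :
    IsCoenvelopeClosed (R.rightOrthogonal.shift (1 : ℤ)) where
  zero X hX _ _ _ := ((shiftFunctor C (1 : ℤ)).map_isZero hX).eq_of_tgt _ _
  prod := .of_fan fun _ _ _ hc h => by
    obtain ⟨hc'⟩ := nonempty_isLimit_map_fan (shiftFunctor C (1 : ℤ)) hc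
    exact (rightOrthogonal_closedUnderSmallProducts R).fan hc' h
  holim Y φ h0 h A hA := by
    intro X u hX
    obtain ⟨c, hc, f, d, k, hd, hT⟩ := hA
    have hZ (i : ℕ) : ∃ (Z : C) (g : Y i ⟶ Z) (h : Z ⟶ (Y (i + 1))⟦(1 : ℤ)⟧),
        Triangle.mk (φ i) g h ∈ distTriang C ∧ ∀ v : X ⟶ Z, v = 0 := by
      obtain ⟨Z, g, l, hZ, hQ⟩ := h i
      exact ⟨Z, g, l, hZ, fun v => R.rightOrthogonal.prop_of_iso (shiftNegShift Z 1) hQ v hX⟩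
    -- This surjectivity is the Mittag-Leffler condition: it makes lim¹ of the groups `Hom(X, Y i)`
    -- vanish.
    have hsurj (i : ℕ) (v : X ⟶ Y i) : ∃ v' : X ⟶ Y (i + 1), v' ≫ φ i = v := by
      obtain ⟨Z, g, l, hZ, hQ⟩ := hZ i
      exact exists_fiber_factor hZ v (hQ _)
    have hY (i : ℕ) (v : X ⟶ (Y i)⟦(1 : ℤ)⟧) : v = 0 := by
      induction i with
      | zero => exact h0 v hX
      | succ i ih =>
        obtain ⟨Z, g, l, hZ, hQ⟩ := hZ i
        obtain ⟨w, rfl⟩ := exists_lift_of_comp_connecting (rot_mk hZ) v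
          (by rw [Preadditive.comp_neg, ih (v ≫ (φ i)⟦(1 : ℤ)⟧'), neg_zero])
        rw [hQ w, zero_comp]
    obtain ⟨hc'⟩ := nonempty_isLimit_map_fan (shiftFunctor C (1 : ℤ)) hc
    obtain ⟨u', rfl⟩ := exists_lift_of_comp_connecting (rot_mk hT) u (by
      rw [Preadditive.comp_neg, neg_eq_zero]
      exact fan_hom_ext hc' fun i => (hY i _).trans zero_comp.symm)
    choose lft hlft using hsurj
    -- Solve `y ≫ d = u'` coordinate by coordinate: `x (i + 1)` lifts `x i` minus the `i`-th
    -- component of `u'`.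
    obtain ⟨x, -, hx⟩ := exists_seq (α := fun i => (X ⟶ Y i)) 0
      (fun i v => lft i (v - u' ≫ c.proj i))
    obtain ⟨y, hy⟩ := exists_fan_lift hc x
    have hyd : y ≫ d = u' := fan_hom_ext hc fun i => by
      rw [Category.assoc, hd, Preadditive.comp_sub, ← Category.assoc, hy, hy, hx, hlft]
      abel
    have hdk : d ≫ k = 0 := comp_distTriang_mor_zero₂₃ _ hT
    rw [← hyd, Category.assoc, hdk, comp_zero]

/-- All terms of the sequence lie in `E` by induction, and a homotopy limit is the fibre of an
endomorphism of their product. -/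
lemma isCoenvelopeClosed_of_isTriangulated (E : ObjectProperty C) [E.IsTriangulated]
    [E.IsClosedUnderIsomorphisms] (hE : ClosedUnderSmallProducts E) : IsCoenvelopeClosed E where
  zero _ hX := E.prop_of_isZero hX
  prod := hE
  holim Y φ h0 h X hX := by
    obtain ⟨c, hc, f, d, k, -, hT⟩ := hX
    have hY (i : ℕ) : E (Y i) := by
      induction i with
      | zero => exact h0
      | succ i ih =>
        obtain ⟨Z, g, l, hZ, hQ⟩ := h i
        exact E.ext_of_isTriangulatedClosed₁ _ hZ ih
          (E.prop_of_iso (shiftNegShift Z 1) (E.le_shift 1 _ hQ))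
    exact E.ext_of_isTriangulatedClosed₁ _ hT (hE.nat_fan hc hY) (hE.nat_fan hc hY)

variable {S : ObjectProperty C}

lemma exists_iso_shift_nat (hshift : translate S 1 ≤ S.isoClosure) (n : ℕ) {X : C} (hX : S X) :
    ∃ X', S X' ∧ Nonempty (X⟦(n : ℤ)⟧ ≅ X') := by
  induction n with
  | zero => exact ⟨X, hX, ⟨(shiftFunctorZero' C _ (by simp)).app X⟩⟩
  | succ n ih =>
    obtain ⟨X', hX', ⟨e⟩⟩ := ih
    obtain ⟨X'', hX'', ⟨e'⟩⟩ := hshift _ ⟨X', hX', ⟨Iso.refl _⟩⟩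
    exact ⟨X'', hX'', ⟨(shiftFunctorAdd' C (n : ℤ) 1 _ (by simp)).app X ≪≫
      (shiftFunctor C (1 : ℤ)).mapIso e ≪≫ e'⟩⟩

lemma classOne_shift_neg (hshift : translate S 1 ≤ S.isoClosure) {X : C} (hX : classOne S X) :
    classOne S (X⟦(-1 : ℤ)⟧) := by
  rintro Y f ⟨s, hs, ⟨e⟩⟩
  obtain ⟨s', hs', ⟨e'⟩⟩ := hshift _ ⟨s, hs, ⟨Iso.refl _⟩⟩
  apply (shiftFunctor C (1 : ℤ)).map_injective
  have h : (shiftNegShift X (1 : ℤ)).inv ≫ f⟦(1 : ℤ)⟧' = 0 :=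
    hX _ ⟨s', hs', ⟨(shiftFunctor C (1 : ℤ)).mapIso (e'.symm ≪≫ e)⟩⟩
  rw [Functor.map_zero, ← cancel_epi (shiftNegShift X (1 : ℤ)).inv, h, comp_zero]

lemma coenvelope_shift_one (hshift : translate S 1 ≤ S.isoClosure) {X : C}
    (hX : coenvelope S X) : coenvelope S (X⟦(1 : ℤ)⟧) :=
  coenvelope_shift (fun Y hY => by
    obtain ⟨Y', hY', ⟨e⟩⟩ := hshift _ ⟨Y, hY, ⟨Iso.refl _⟩⟩
    exact (coenvelope S).prop_of_iso e.symm (le_coenvelope _ _ hY')) hX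

/-- The `Y` for which this holds form a class closed under the coenvelope operations, and it
contains `S` by definition of `classOne`. -/
lemma classOne_orthogonal {X Y : C} (hX : classOne S X) (hY : coenvelope S Y)
    (f : X ⟶ Y⟦(1 : ℤ)⟧) : f = 0 :=
  coenvelope_le (rightOrthogonal_shift_isCoenvelopeClosed (classOne S))
    (fun _ hs _ g hX => hX g ⟨_, hs, ⟨Iso.refl _⟩⟩) Y hY f hX

lemma classOne_ext (T : Triangle C) (hT : T ∈ distTriang C) (h1 : classOne S T.obj₁)
    (h3 : classOne S T.obj₃) : classOne S T.obj₂ :=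
  ObjectProperty.ext_of_isTriangulatedClosed₂ (translate S 1).leftOrthogonal T hT h1 h3

instance : (classOne S).IsClosedUnderIsomorphisms :=
  inferInstanceAs (translate S 1).leftOrthogonal.IsClosedUnderIsomorphisms

instance : (classOne S).IsStableUnderRetracts :=
  inferInstanceAs (translate S 1).leftOrthogonal.IsStableUnderRetracts

lemma factorsFinitely_of_translate (hS : ∀ X, S X → FactorsFinitely X) {n : ℤ} {X : C}
    (hX : translate S n X) : FactorsFinitely X := by
  obtain ⟨Y, hY, ⟨e⟩⟩ := hX
  exact ((hS Y hY).shift n).of_iso e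

lemma classOne_closedUnderSmallProducts (hS : ∀ X, S X → FactorsFinitely X) :
    ClosedUnderSmallProducts (classOne S) :=
  leftOrthogonal_closedUnderSmallProducts fun _ hX => factorsFinitely_of_translate hS hX

lemma coenvelope_isStableUnderRetracts [HasProducts.{v} C]
    (hshift : translate S 1 ≤ S.isoClosure) : (coenvelope S).IsStableUnderRetracts := by
  have : HasProducts.{0} C := has_smallest_products_of_hasProducts.{v}
  exact (coenvelope_isCoenvelopeClosed S).isStableUnderRetracts
    fun _ hA => coenvelope_shift_one hshift hA

lemma exists_weight_decomposition [IsTriangulated C] [HasProducts.{v} C]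
    [ObjectProperty.EssentiallySmall.{v} S] (hS : ∀ X, S X → FactorsFinitely X) (M : C) :
    ∃ (B A : C) (b : B ⟶ M) (a : M ⟶ A) (f : A ⟶ B⟦(1 : ℤ)⟧),
      Triangle.mk b a f ∈ distTriang C ∧ classOne S B ∧ translate (coenvelope S) 1 A := by
  obtain ⟨B, A, b, a, f, hT, hB, hA⟩ := exists_orthogonal_decomposition (translate S 1)
    (fun X hX => factorsFinitely_of_translate hS hX) M
  rw [coenvelope_translate] at hA
  exact ⟨B, A, b, a, f, hT, hB, hA⟩

/-- The weight structure cogenerated by an essentially small class of cocompact objects that is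
closed under positive shifts. -/
def cogeneratedWeightStructure [IsTriangulated C] [HasProducts.{v} C]
    [ObjectProperty.EssentiallySmall.{v} S] (hS : ∀ X, S X → FactorsFinitely X)
    (hshift : translate S 1 ≤ S.isoClosure) : WeightStructure C where
  le := classOne S
  ge := coenvelope S
  le_retract := inferInstance
  ge_retract := coenvelope_isStableUnderRetracts hshift
  le_translate X hX := (translate_iff _ _ _).2 (classOne_shift_neg hshift hX)
  translate_ge := by
    rintro X ⟨Y, hY, ⟨e⟩⟩
    exact (coenvelope S).prop_of_iso e (coenvelope_shift_one hshift hY)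
  orthogonal := by
    rintro X Z hX ⟨Y, hY, ⟨e⟩⟩ f
    rw [← cancel_mono e.inv, classOne_orthogonal hX hY (f ≫ e.inv), zero_comp]
  exists_decomposition := exists_weight_decomposition hS

/-- The union of all `S[i]` for `i ≤ 0`. -/
def nonposShifts (S : ObjectProperty C) : ObjectProperty C :=
  fun X => ∃ i : ℤ, i ≤ 0 ∧ translate S i X

lemma le_nonposShifts (S : ObjectProperty C) : S ≤ nonposShifts S :=
  fun X hX => ⟨0, le_rfl, X, hX, ⟨(shiftFunctorZero C ℤ).app X⟩⟩

instance : (nonposShifts S).IsClosedUnderIsomorphisms where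
  of_iso := by
    rintro X Y e ⟨i, hi, Z, hZ, ⟨e'⟩⟩
    exact ⟨i, hi, Z, hZ, ⟨e' ≪≫ e⟩⟩

instance [ObjectProperty.EssentiallySmall.{v} S] :
    ObjectProperty.EssentiallySmall.{v} (nonposShifts S) := by
  have h : nonposShifts S = ⨆ i : {i : ℤ // i ≤ 0}, translate S i.1 := by
    ext X
    simp [nonposShifts]
  rw [h]
  infer_instance

/-- Positive shifts of `S` stay in `S` up to isomorphism, so the nonpositive ones already exhaust
all shifts. -/
lemma nonposShifts_isStableUnderShift (hshift : translate S 1 ≤ S.isoClosure) :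
    (nonposShifts S).IsStableUnderShift ℤ where
  isStableUnderShiftBy n := ⟨by
    rintro X ⟨i, hi, Y, hY, ⟨e⟩⟩
    change nonposShifts S (X⟦n⟧)
    have e' : Y⟦i + n⟧ ≅ X⟦n⟧ :=
      (shiftFunctorAdd C i n).app Y ≪≫ (shiftFunctor C n).mapIso e
    by_cases h : i + n ≤ 0
    · exact ⟨_, h, Y, hY, ⟨e'⟩⟩
    · obtain ⟨m, hm⟩ := Int.eq_ofNat_of_zero_le (show 0 ≤ i + n by omega)
      obtain ⟨Y', hY', ⟨e''⟩⟩ := exists_iso_shift_nat hshift m hY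
      rw [← hm] at e''
      exact (nonposShifts S).prop_of_iso (e''.symm ≪≫ e') (le_nonposShifts _ _ hY')⟩

lemma factorsFinitely_of_nonposShifts (hS : ∀ X, S X → FactorsFinitely X) {X : C}
    (hX : nonposShifts S X) : FactorsFinitely X := by
  obtain ⟨i, -, hX⟩ := hX
  exact factorsFinitely_of_translate hS hX

instance : (cogen S).IsClosedUnderIsomorphisms :=
  inferInstanceAs (coenvelope _).IsClosedUnderIsomorphisms

lemma cogen_closedUnderSmallProducts (S : ObjectProperty C) :
    ClosedUnderSmallProducts (cogen S) :=
  (coenvelope_isCoenvelopeClosed (nonposShifts S)).prod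

lemma coenvelope_le_cogen (S : ObjectProperty C) : coenvelope S ≤ cogen S :=
  coenvelope_mono (Q := nonposShifts S) fun X hX => le_coenvelope _ _ (le_nonposShifts _ X hX)

lemma cogen_isTriangulated [HasProducts.{v} C] (hshift : translate S 1 ≤ S.isoClosure) :
    (cogen S).IsTriangulated where
  exists_zero := ⟨_, isZero_zero C, (coenvelope_isCoenvelopeClosed (nonposShifts S)).zero _
    (isZero_zero C)⟩
  isStableUnderShiftBy n := ⟨fun X hX => by
    have := nonposShifts_isStableUnderShift hshift
    exact coenvelope_shift (P' := nonposShifts S)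
      (fun Y hY => le_coenvelope _ _ ((nonposShifts S).le_shift n _ hY)) hX⟩
  toIsTriangulatedClosed₂ := by
    have : HasProducts.{0} C := has_smallest_products_of_hasProducts.{v}
    exact .mk' (coenvelope_isCoenvelopeClosed (nonposShifts S)).ext

lemma nonposShifts_le_of_isTriangulated {E : ObjectProperty C} (hE : E.IsTriangulated)
    (hE' : E.IsClosedUnderIsomorphisms) (hS : S ≤ E) : nonposShifts S ≤ E := by
  rintro X ⟨i, -, Y, hY, ⟨e⟩⟩
  exact E.prop_of_iso e (E.le_shift i _ (hS _ hY))

lemma cogen_le {E : ObjectProperty C} (hE : E.IsTriangulated)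
    (hE' : E.IsClosedUnderIsomorphisms) (hprod : ClosedUnderSmallProducts E) (hS : S ≤ E) :
    cogen S ≤ E :=
  coenvelope_le (isCoenvelopeClosed_of_isTriangulated E hprod)
    (nonposShifts_le_of_isTriangulated hE hE' hS)

/-- The right orthogonal of a shift-stable left orthogonal is triangulated, so it contains the
triangulated closure of `S`. -/
lemma perp_eq (hshift : translate S 1 ≤ S.isoClosure) :
    perp S = (nonposShifts S).leftOrthogonal := by
  have := nonposShifts_isStableUnderShift hshift
  ext X
  constructor
  · exact fun hX Y f hY => hX f fun Q hQ hQ' hS => nonposShifts_le_of_isTriangulated hQ hQ' hS Y hY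
  · exact fun hX Y f hY => hY (nonposShifts S).leftOrthogonal.rightOrthogonal inferInstance
      inferInstance (fun s hs Z g hZ => hZ g (le_nonposShifts _ _ hs)) f hX

lemma perp_isTriangulated (hshift : translate S 1 ≤ S.isoClosure) : (perp S).IsTriangulated := by
  have := nonposShifts_isStableUnderShift hshift
  rw [perp_eq hshift]
  infer_instance

lemma perp_closedUnderSmallProducts (hS : ∀ X, S X → FactorsFinitely X)
    (hshift : translate S 1 ≤ S.isoClosure) : ClosedUnderSmallProducts (perp S) := by
  rw [perp_eq hshift]
  exact leftOrthogonal_closedUnderSmallProducts fun _ hX => factorsFinitely_of_nonposShifts hS hX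

lemma perp_le_classOne (hshift : translate S 1 ≤ S.isoClosure) : perp S ≤ classOne S := by
  have := nonposShifts_isStableUnderShift hshift
  rw [perp_eq hshift]
  rintro X hX Y f ⟨s, hs, ⟨e⟩⟩
  exact hX f ((nonposShifts S).prop_of_iso e
    ((nonposShifts S).le_shift 1 _ (le_nonposShifts _ _ hs)))

/-- Objects of the cogenerated subcategory that belong to all `⊥(S[1])[l]` vanish. -/
lemma isZero_of_forall_translate_classOne (hshift : translate S 1 ≤ S.isoClosure) {X : C}
    (hX : cogen S X) (h : ∀ l : ℤ, translate (classOne S) l X) : IsZero X := by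
  have := nonposShifts_isStableUnderShift hshift
  have hX' : (nonposShifts S).leftOrthogonal X := by
    rintro Y f ⟨i, -, s, hs, ⟨e⟩⟩
    have h1 : classOne S (X⟦1 - i⟧) := by
      have := (translate_iff _ _ _).1 (h (i - 1))
      rwa [neg_sub] at this
    apply (shiftFunctor C (1 - i)).map_injective
    rw [Functor.map_zero]
    exact h1 _ ⟨s, hs, ⟨(shiftFunctorAdd' C i (1 - i) 1 (by omega)).app s ≪≫
      (shiftFunctor C (1 - i)).mapIso e⟩⟩
  -- The double orthogonal is triangulated, closed under products and contains `S`, hence contains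
  -- `cogen S`; so `X` is orthogonal to itself.
  have h2 : (nonposShifts S).leftOrthogonal.rightOrthogonal X :=
    cogen_le inferInstance inferInstance (rightOrthogonal_closedUnderSmallProducts _)
      (fun s hs Z g hZ => hZ g (le_nonposShifts _ _ hs)) X hX
  exact (IsZero.iff_id_eq_zero X).2 (h2 (𝟙 X) hX')

/-- Every object is an extension of an object of `cogen S` by an object of `perp S`. -/
lemma exists_perp_cogen_decomposition [IsTriangulated C] [HasProducts.{v} C]
    [ObjectProperty.EssentiallySmall.{v} S] (hS : ∀ X, S X → FactorsFinitely X)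
    (hshift : translate S 1 ≤ S.isoClosure) (M : C) :
    ∃ (B A : C) (b : B ⟶ M) (a : M ⟶ A) (f : A ⟶ B⟦(1 : ℤ)⟧),
      Triangle.mk b a f ∈ distTriang C ∧ perp S B ∧ cogen S A := by
  rw [perp_eq hshift]
  exact exists_orthogonal_decomposition (nonposShifts S)
    (fun X hX => factorsFinitely_of_nonposShifts hS hX) M

/-- In `B ⟶ X ⟶ A` with `B` in `perp S` and `A` in `cogen S`, the object `A` is an extension of
`B⟦1⟧` by `X`, so it stays in `classOne S`. -/
lemma classOne_eq_extensionClosure [IsTriangulated C] [HasProducts.{v} C]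
    [ObjectProperty.EssentiallySmall.{v} S] (hS : ∀ X, S X → FactorsFinitely X)
    (hshift : translate S 1 ≤ S.isoClosure) :
    classOne S = extensionClosure ((classOne S ⊓ cogen S) ⊔ perp S) := by
  have hperp := perp_isTriangulated hshift
  apply le_antisymm
  · intro X hX Q hQ hle
    obtain ⟨B, A, b, a, f, hT, hB, hA⟩ := exists_perp_cogen_decomposition hS hshift X
    refine hQ.ext _ hT (hle _ (Or.inr hB)) (hle _ (Or.inl ⟨?_, hA⟩))
    exact classOne_ext _ (rot_mk hT) hX (perp_le_classOne hshift _ ((perp S).le_shift 1 _ hB))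
  · refine fun X hX => hX _ ⟨fun Y hY Z f _ => hY.eq_of_src _ _, classOne_ext⟩ ?_
    exact sup_le inf_le_left (perp_le_classOne hshift)

end Classes

/-! ### Restriction to a triangulated subcategory. -/

section FullSubcategory

variable {C : Type u} [Category.{v} C]

lemma ClosedUnderSmallProducts.preservesLimitsOfShape_ι [HasProducts.{v} C] {P : ObjectProperty C}
    (hP : ClosedUnderSmallProducts P) (I : Type v) :
    PreservesLimitsOfShape (Discrete I) P.ι := by
  have := hP I
  infer_instance

lemma ClosedUnderSmallProducts.hasProducts [HasProducts.{v} C] {P : ObjectProperty C}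
    (hP : ClosedUnderSmallProducts P) : HasProducts.{v} P.FullSubcategory := by
  intro I
  have := hP I
  exact hasLimitsOfShape_of_hasLimitsOfShape_createsLimitsOfShape P.ι

lemma ClosedUnderSmallProducts.inverseImage_ι [HasProducts.{v} C] {P Q : ObjectProperty C}
    (hP : ClosedUnderSmallProducts P) (hQ : ClosedUnderSmallProducts Q) :
    ClosedUnderSmallProducts (Q.inverseImage P.ι) := by
  intro I
  have := hQ I
  have := hP.preservesLimitsOfShape_ι I
  infer_instance

variable [Preadditive C] [HasZeroObject C] [HasShift C ℤ]
  [∀ n : ℤ, (shiftFunctor C n).Additive] [Pretriangulated C]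
  (P : ObjectProperty C) [P.IsTriangulated]

lemma exists_distinguished_lift {X Y Z : P.FullSubcategory} {f : X.obj ⟶ Y.obj}
    {g : Y.obj ⟶ Z.obj} {h : Z.obj ⟶ X.obj⟦(1 : ℤ)⟧} (hT : Triangle.mk f g h ∈ distTriang C) :
    ∃ k : Z ⟶ X⟦(1 : ℤ)⟧,
      Triangle.mk (P.fullyFaithfulι.preimage f) (P.fullyFaithfulι.preimage g) k ∈
        distTriang P.FullSubcategory := by
  refine ⟨P.fullyFaithfulι.preimage (h ≫ (P.ι.commShiftIso (1 : ℤ)).inv.app X), ?_⟩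
  refine isomorphic_distinguished _ hT _ (Triangle.isoMk _ _ (Iso.refl _) (Iso.refl _) (Iso.refl _)
    ?_ ?_ ?_)
  · change P.ι.map (P.fullyFaithfulι.preimage f) ≫ 𝟙 _ = 𝟙 _ ≫ f
    rw [Functor.FullyFaithful.map_preimage]
    exact (Category.comp_id _).trans (Category.id_comp _).symm
  · change P.ι.map (P.fullyFaithfulι.preimage g) ≫ 𝟙 _ = 𝟙 _ ≫ g
    rw [Functor.FullyFaithful.map_preimage]
    exact (Category.comp_id _).trans (Category.id_comp _).symm
  · change (P.ι.map (P.fullyFaithfulι.preimage (h ≫ (P.ι.commShiftIso (1 : ℤ)).inv.app X)) ≫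
      (P.ι.commShiftIso (1 : ℤ)).hom.app X) ≫ (𝟙 _)⟦(1 : ℤ)⟧' = 𝟙 _ ≫ h
    rw [Functor.FullyFaithful.map_preimage]
    simp

lemma distinguished_map_ι {X Y Z : P.FullSubcategory} {f : X ⟶ Y} {g : Y ⟶ Z}
    {h : Z ⟶ X⟦(1 : ℤ)⟧} (hT : Triangle.mk f g h ∈ distTriang P.FullSubcategory) :
    ∃ k : Z.obj ⟶ X.obj⟦(1 : ℤ)⟧, Triangle.mk f.hom g.hom k ∈ distTriang C :=
  ⟨_, P.ι.map_distinguished _ hT⟩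

lemma translate_inverseImage_ι_iff {Q : ObjectProperty C} [Q.IsClosedUnderIsomorphisms] (n : ℤ)
    (X : P.FullSubcategory) : translate (Q.inverseImage P.ι) n X ↔ translate Q n X.obj := by
  rw [translate_iff, translate_iff]
  exact Q.prop_iff_of_iso ((P.ι.commShiftIso (-n)).app X)

variable [P.IsClosedUnderIsomorphisms]

/-- The restriction of a weight structure to a triangulated subcategory that contains all objects
of nonnegative weight. -/
def WeightStructure.restrict (w : WeightStructure C) (h : w.ge ≤ P) :
    WeightStructure P.FullSubcategory where
  le := (w.le ⊓ P).inverseImage P.ι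
  ge := w.ge.inverseImage P.ι
  le_retract := ⟨fun {X Y} ρ hY => by
    have := w.le_retract
    exact ⟨w.le.prop_of_retract (ρ.map P.ι) hY.1, X.property⟩⟩
  ge_retract := ⟨fun ρ hY => by
    have := w.ge_retract
    exact w.ge.prop_of_retract (ρ.map P.ι) hY⟩
  le_translate X hX := by
    have := w.le_retract
    rw [translate_inverseImage_ι_iff, translate_iff]
    exact ⟨(translate_iff _ _ _).1 (w.le_translate _ hX.1), P.le_shift (-1) _ X.property⟩
  translate_ge X hX := by
    have := w.ge_retract
    rw [translate_inverseImage_ι_iff] at hX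
    exact w.translate_ge _ hX
  orthogonal X Y hX hY f := by
    have := w.ge_retract
    rw [translate_inverseImage_ι_iff] at hY
    exact P.ι.map_injective ((w.orthogonal hX.1 hY (P.ι.map f)).trans (P.ι.map_zero _ _).symm)
  exists_decomposition M := by
    have := w.ge_retract
    obtain ⟨B, A, b, a, f, hT, hB, hA⟩ := w.exists_decomposition M.obj
    -- The third term lies in `P` by its weight, hence so does the fibre `B`.
    have hA' : P A := h _ (w.translate_ge _ hA)
    have hB' : P B := P.ext_of_isTriangulatedClosed₁ _ hT M.property hA'
    obtain ⟨k, hk⟩ := exists_distinguished_lift P (X := ⟨B, hB'⟩) (Y := M) (Z := ⟨A, hA'⟩) hT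
    exact ⟨_, _, _, _, _, hk, ⟨hB, hB'⟩, (translate_inverseImage_ι_iff P 1 _).2 hA⟩

end FullSubcategory

/-! ### Fibres of a morphism of triangles. -/

section NineLemma

variable {C : Type u} [Category.{v} C] [Preadditive C] [HasZeroObject C] [HasShift C ℤ]
  [∀ n : ℤ, (shiftFunctor C n).Additive] [Pretriangulated C]

lemma distinguished_of_iso₃ {X Y Z Z' : C} {f : X ⟶ Y} {g : Y ⟶ Z} {h : Z ⟶ X⟦(1 : ℤ)⟧}
    (hT : Triangle.mk f g h ∈ distTriang C) (e : Z ≅ Z') :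
    Triangle.mk f (g ≫ e.hom) (e.inv ≫ h) ∈ distTriang C := by
  refine isomorphic_distinguished _ hT _ (Triangle.isoMk _ _ (Iso.refl _) (Iso.refl _) e.symm
    ?_ ?_ ?_)
  · exact (Category.comp_id _).trans (Category.id_comp _).symm
  · change (g ≫ e.hom) ≫ e.inv = 𝟙 _ ≫ g
    simp
  · change (e.inv ≫ h) ≫ (𝟙 X)⟦(1 : ℤ)⟧' = e.inv ≫ h
    simp

lemma distinguished_of_iso₂ {X Y Y' Z : C} {f : X ⟶ Y} {g : Y ⟶ Z} {h : Z ⟶ X⟦(1 : ℤ)⟧}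
    (hT : Triangle.mk f g h ∈ distTriang C) (e : Y ≅ Y') :
    Triangle.mk (f ≫ e.hom) (e.inv ≫ g) h ∈ distTriang C := by
  refine isomorphic_distinguished _ hT _ (Triangle.isoMk _ _ (Iso.refl _) e.symm (Iso.refl _)
    ?_ ?_ ?_)
  · change (f ≫ e.hom) ≫ e.inv = 𝟙 _ ≫ f
    simp
  · change (e.inv ≫ g) ≫ 𝟙 _ = e.inv ≫ g
    simp
  · change h ≫ (𝟙 X)⟦(1 : ℤ)⟧' = 𝟙 _ ≫ h
    simp

/-- A form of the `3 × 3` lemma: a commutative square between the second morphisms of two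
distinguished triangles extends to a morphism of triangles whose fibers form a distinguished
triangle. -/
lemma exists_fiber_triangle [IsTriangulated C] {X Y Z X' Y' Z' V W : C}
    {f : X ⟶ Y} {g : Y ⟶ Z} {h : Z ⟶ X⟦(1 : ℤ)⟧} (hT : Triangle.mk f g h ∈ distTriang C)
    {f' : X' ⟶ Y'} {g' : Y' ⟶ Z'} {h' : Z' ⟶ X'⟦(1 : ℤ)⟧}
    (hT' : Triangle.mk f' g' h' ∈ distTriang C)
    {b : V ⟶ Y} {v : Y ⟶ Y'} {k : Y' ⟶ V⟦(1 : ℤ)⟧} (hv : Triangle.mk b v k ∈ distTriang C)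
    {c : W ⟶ Z} {w : Z ⟶ Z'} {l : Z' ⟶ W⟦(1 : ℤ)⟧} (hw : Triangle.mk c w l ∈ distTriang C)
    (comm : g ≫ w = v ≫ g') :
    ∃ (U : C) (a : U ⟶ X) (u : X ⟶ X') (j : X' ⟶ U⟦(1 : ℤ)⟧) (p : U ⟶ V) (q : V ⟶ W)
      (r : W ⟶ U⟦(1 : ℤ)⟧), f ≫ v = u ≫ f' ∧ Triangle.mk a u j ∈ distTriang C ∧
        Triangle.mk p q r ∈ distTriang C := by
  -- `E` is the fibre of the diagonal of the square. Its two factorizations give triangles `X ⟶ E ⟶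
  -- W` and `V ⟶ E ⟶ X'`; the composite `X ⟶ E ⟶ X'` is the required `u`, and a third octahedron
  -- computes its fibre.
  obtain ⟨E, e, m, hE⟩ := distinguished_cocone_triangle₁ (g ≫ w)
  let o := Triangulated.someOctahedron' rfl hT hw hE
  let o' := Triangulated.someOctahedron' comm.symm hv hT' hE
  obtain ⟨U, a, j, hU⟩ := distinguished_cocone_triangle₁ (o.m₁ ≫ o'.m₃)
  obtain ⟨x, y, hx⟩ := inv_rot_mk o.mem
  let o'' := Triangulated.someOctahedron' rfl hx o'.mem hU
  refine ⟨U, a, o.m₁ ≫ o'.m₃, j, o''.m₃, _, _, ?_, hU,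
    distinguished_of_iso₃ (rot_mk o''.mem) (shiftNegShift W (1 : ℤ))⟩
  rw [Category.assoc, o'.comm₄, ← Category.assoc, o.comm₁]

end NineLemma

/-! ### Products of triangles, towers and weight complexes. -/

section Products

variable {C : Type u} [Category.{v} C]

lemma isIso_of_fan {I : Type*} {Y : I → C} {c c' : Fan Y} (hc : IsLimit c) (hc' : IsLimit c')
    (g : c.pt ⟶ c'.pt) (h : ∀ i, g ≫ c'.proj i = c.proj i) : IsIso g := by
  obtain ⟨k, hk⟩ := exists_fan_lift hc (fun i => c'.proj i)
  exact ⟨k, fan_hom_ext hc fun i => by rw [Category.assoc, hk, h, Category.id_comp],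
    fan_hom_ext hc' fun i => by rw [Category.assoc, h, hk, Category.id_comp]⟩

variable [Preadditive C] [HasZeroObject C] [HasShift C ℤ]
  [∀ n : ℤ, (shiftFunctor C n).Additive] [Pretriangulated C]

section

variable {I : Type*} [HasProductsOfShape I C] {T' : I → Triangle C}

lemma distinguished_of_fans {T : Triangle C} (π : ∀ i, T ⟶ T' i)
    (h₁ : IsLimit (Fan.mk T.obj₁ fun i => (π i).hom₁))
    (h₂ : IsLimit (Fan.mk T.obj₂ fun i => (π i).hom₂))
    (h₃ : IsLimit (Fan.mk T.obj₃ fun i => (π i).hom₃))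
    (hT' : ∀ i, T' i ∈ distTriang C) : T ∈ distTriang C := by
  let φ := productTriangle.lift T' π
  have i₁ : IsIso φ.hom₁ := isIso_of_fan h₁ (productIsProduct _) _ fun i => by
    simp [φ, Fan.proj]
  have i₂ : IsIso φ.hom₂ := isIso_of_fan h₂ (productIsProduct _) _ fun i => by
    simp [φ, Fan.proj]
  have i₃ : IsIso φ.hom₃ := isIso_of_fan h₃ (productIsProduct _) _ fun i => by
    simp [φ, Fan.proj]
  have : IsIso φ := Triangle.isIso_of_isIsos _ i₁ i₂ i₃
  exact isomorphic_distinguished _ (productTriangle_distinguished T' hT') _ (asIso φ)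

/-- The cone of a product of morphisms is the product of the cones. -/
lemma nonempty_iso_pi_cone {c₁ : Fan fun i => (T' i).obj₁} {c₂ : Fan fun i => (T' i).obj₂}
    (hT' : ∀ i, T' i ∈ distTriang C) (h₁ : IsLimit c₁) (h₂ : IsLimit c₂)
    {m : c₁.pt ⟶ c₂.pt} (hm : ∀ i, m ≫ c₂.proj i = c₁.proj i ≫ (T' i).mor₁)
    {Z : C} {g : c₂.pt ⟶ Z} {h : Z ⟶ c₁.pt⟦(1 : ℤ)⟧} (hT : Triangle.mk m g h ∈ distTriang C) :
    Nonempty (Z ≅ ∏ᶜ fun i => (T' i).obj₃) := by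
  let e₁ := h₁.conePointUniqueUpToIso (productIsProduct fun i => (T' i).obj₁)
  let e₂ := h₂.conePointUniqueUpToIso (productIsProduct fun i => (T' i).obj₂)
  have he₁ (i) : e₁.hom ≫ Pi.π _ i = c₁.proj i :=
    h₁.conePointUniqueUpToIso_hom_comp _ ⟨i⟩
  have he₂ (i) : e₂.hom ≫ Pi.π _ i = c₂.proj i :=
    h₂.conePointUniqueUpToIso_hom_comp _ ⟨i⟩
  obtain ⟨e', -⟩ := exists_iso_of_arrow_iso _ _ hT (productTriangle_distinguished T' hT')
    (Arrow.isoMk e₁ e₂ (by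
      change e₁.hom ≫ Limits.Pi.map (fun i => (T' i).mor₁) = m ≫ e₂.hom
      refine Pi.hom_ext _ _ fun i => ?_
      rw [Category.assoc, Category.assoc, Pi.map_π, he₂, hm, ← Category.assoc, he₁]))
  exact ⟨Triangle.π₃.mapIso e'⟩

/-- The fiber of a product of morphisms is the product of the fibers. -/
lemma nonempty_iso_pi_fiber {c₂ : Fan fun i => (T' i).obj₂} {c₃ : Fan fun i => (T' i).obj₃}
    (hT' : ∀ i, T' i ∈ distTriang C) (h₂ : IsLimit c₂) (h₃ : IsLimit c₃)
    {m : c₂.pt ⟶ c₃.pt} (hm : ∀ i, m ≫ c₃.proj i = c₂.proj i ≫ (T' i).mor₂)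
    {Z : C} {f : Z ⟶ c₂.pt} {h : c₃.pt ⟶ Z⟦(1 : ℤ)⟧} (hT : Triangle.mk f m h ∈ distTriang C) :
    Nonempty (Z ≅ ∏ᶜ fun i => (T' i).obj₁) := by
  obtain ⟨e⟩ := nonempty_iso_pi_cone (T' := fun i => (T' i).rotate)
    (fun i => rot_of_distTriang _ (hT' i)) h₂ h₃ hm (rot_mk hT)
  obtain ⟨hc⟩ := nonempty_isLimit_map_fan (shiftFunctor C (1 : ℤ))
    (productIsProduct fun i => (T' i).obj₁)
  let e' := hc.conePointUniqueUpToIso (productIsProduct fun i => (T' i).obj₁⟦(1 : ℤ)⟧)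
  exact ⟨(shiftEquiv C (1 : ℤ)).functor.preimageIso (e ≪≫ e'.symm)⟩

end

lemma ClosedUnderSmallProducts.translate {Q : ObjectProperty C}
    (hQ : ClosedUnderSmallProducts Q) (n : ℤ) :
    ClosedUnderSmallProducts (translate Q n) :=
  .of_fan fun I Y c hc h => by
    have := hQ.isClosedUnderIsomorphisms
    obtain ⟨hc'⟩ := nonempty_isLimit_map_fan (shiftFunctor C (-n)) hc
    rw [translate_iff]
    exact hQ.fan hc' fun i => (translate_iff _ _ _).1 (h i)

namespace WeightStructure

variable {w : WeightStructure C}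

lemma productsOfDecompositions [HasProducts.{v} C] (hle : ClosedUnderSmallProducts w.le)
    (hge : ClosedUnderSmallProducts w.ge) : w.ProductsOfDecompositions :=
  fun n _ _ _ π ⟨h₁⟩ ⟨h₂⟩ ⟨h₃⟩ hT' =>
    ⟨distinguished_of_fans π h₁ h₂ h₃ fun i => (hT' i).dist,
      (hle.translate n).fan h₁ fun i => (hT' i).le,
      (hge.translate (n + 1)).fan h₃ fun i => (hT' i).ge⟩

lemma productsOfWeightTowers [HasProducts.{v} C] (hge : ClosedUnderSmallProducts w.ge)
    (hle : ClosedUnderSmallProducts w.le) : w.ProductsOfWeightTowers := by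
  rintro I M M' f P P' π ⟨hf⟩ hY hG hP'
  refine ⟨⟨fun j i h => ?_, fun j i h => ?_⟩, fun j => ?_⟩
  · refine fan_hom_ext hf fun i' => ?_
    change (P.map j i h ≫ P.toObj i) ≫ f i' = P.toObj j ≫ f i'
    rw [Category.assoc, (π i').comm_toObj, ← Category.assoc, (π i').comm_map, Category.assoc,
      (hP' i').postnikov.comm, (π i').comm_toObj]
  · refine distinguished_of_fans (T' := fun i' => Triangle.mk ((P' i').map j i h) ((P' i').proj i)
      ((P' i').δ i j h)) (fun i' => Triangle.homMk _ _ ((π i').homY j) ((π i').homY i)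
      ((π i').homG i) ((π i').comm_map j i h) ((π i').comm_proj i) ((π i').comm_δ i j h))
      (hY j).some (hY i).some (hG i).some (fun i' => (hP' i').postnikov.dist j i h)
  · choose A a k hT using fun i' => (hP' i').decomposition j
    -- A tower carries no complements `A`; any cone of `P.toObj j` is the product of the given
    -- complements.
    obtain ⟨A₀, a₀, k₀, hT₀⟩ := distinguished_cocone_triangle (P.toObj j)
    refine ⟨A₀, a₀, k₀, hT₀, (hle.translate j).fan (hY j).some fun i' => (hT i').le, ?_⟩
    obtain ⟨e⟩ := nonempty_iso_pi_cone (fun i' => (hT i').dist) (hY j).some hf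
      (fun i' => (π i').comm_toObj j) hT₀
    have := (hge.translate (j + 1)).isClosedUnderIsomorphisms
    exact (translate w.ge (j + 1)).prop_of_iso e.symm
      ((hge.translate (j + 1)).pi _ fun i' => (hT i').ge)

end WeightStructure

/-- A morphism of towers induces morphisms of the associated complexes. -/
lemma TowerData.Hom.comm_d {M M' : C} {f : M ⟶ M'} {P : TowerData M} {P' : TowerData M'}
    (π : P.Hom P' f) (p q : ℤ) (h : p + 1 = q) :
    (π.homG (-p))⟦p⟧' ≫ P'.d p q h = P.d p q h ≫ (π.homG (-q))⟦q⟧' := by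
  have e := (shiftFunctorAdd' C 1 p q (by omega)).inv.naturality (π.homG (-q))
  simp only [Functor.comp_map] at e
  simp only [TowerData.d, Category.assoc]
  rw [← e, ← Category.assoc, ← Category.assoc, ← Functor.map_comp, ← Functor.map_comp]
  congr 2
  rw [← Category.assoc, ← π.comm_δ, Category.assoc, Category.assoc, ← Functor.map_comp,
    ← Functor.map_comp, π.comm_proj]

lemma TowerData.complex_d {M : C} {P : TowerData M} (hP : P.IsPostnikov) (p : ℤ) :
    (P.complex hP).d p (p + 1) = P.d p (p + 1) rfl := by
  unfold TowerData.complex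
  exact CochainComplex.of_d (fun p : ℤ => (P.G (-p))⟦p⟧) (fun p => P.d p (p + 1) rfl) p

/-- The morphism of complexes induced by a morphism of towers. -/
noncomputable def TowerData.Hom.complexMap {M M' : C} {f : M ⟶ M'} {P : TowerData M}
    {P' : TowerData M'} (π : P.Hom P' f) (hP : P.IsPostnikov) (hP' : P'.IsPostnikov) :
    P.complex hP ⟶ P'.complex hP' :=
  CochainComplex.ofHom (fun p => (π.homG (-p))⟦p⟧')
    (fun p => by
      rw [TowerData.complex_d, TowerData.complex_d]
      exact π.comm_d p (p + 1) rfl)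

lemma TowerData.nonempty_isLimit_complex {I : Type*} {M : C} {M' : I → C} {f : ∀ i, M ⟶ M' i}
    {P : TowerData M} {P' : ∀ i, TowerData (M' i)} (π : ∀ i, P.Hom (P' i) (f i))
    (hG : ∀ j, Nonempty (IsLimit (Fan.mk (P.G j) fun i => (π i).homG j)))
    (hP : P.IsPostnikov) (hP' : ∀ i, (P' i).IsPostnikov) :
    Nonempty (IsLimit (Fan.mk (P.complex hP) fun i => (π i).complexMap hP (hP' i))) := by
  refine ⟨HomologicalComplex.isLimitOfEval _ _ fun p => ?_⟩
  have hc := (nonempty_isLimit_map_fan (shiftFunctor C p) (hG (-p)).some).some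
  exact (isLimitMapConeFanMkEquiv (HomologicalComplex.eval C (ComplexShape.up ℤ) p) _ _).symm hc

/-- Small products of towers exist. -/
lemma TowerData.exists_product {I : Type*} [HasProductsOfShape I C] {M : C} {M' : I → C}
    {f : ∀ i, M ⟶ M' i} (hf : IsLimit (Fan.mk M f)) (P' : ∀ i, TowerData (M' i)) :
    ∃ (P : TowerData M) (π : ∀ i, P.Hom (P' i) (f i)),
      (∀ j, Nonempty (IsLimit (Fan.mk (P.Y j) fun i => (π i).homY j))) ∧
      (∀ j, Nonempty (IsLimit (Fan.mk (P.G j) fun i => (π i).homG j))) := by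
  choose toObj h_obj using fun j => exists_fan_lift hf
    (fun i => Pi.π (fun i => (P' i).Y j) i ≫ (P' i).toObj j)
  choose δ hδ using fun (i j : ℤ) (h : j + 1 = i) => exists_fan_lift
    (nonempty_isLimit_map_fan (shiftFunctor C (1 : ℤ))
      (productIsProduct fun i' => (P' i').Y j)).some
    (fun i' => Pi.π (fun i' => (P' i').G i) i' ≫ (P' i').δ i j h)
  refine ⟨{ Y := fun j => ∏ᶜ fun i => (P' i).Y j
            G := fun j => ∏ᶜ fun i => (P' i).G j
            toObj := toObj
            map := fun j i h => Limits.Pi.map fun i' => (P' i').map j i h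
            proj := fun j => Limits.Pi.map fun i' => (P' i').proj j
            δ := δ }, fun i' =>
          { homY := fun j => Pi.π _ i'
            homG := fun j => Pi.π _ i'
            comm_toObj := fun j => h_obj j i'
            comm_map := fun j i h => Limits.Pi.map_π (fun i' => (P' i').map j i h) i'
            comm_proj := fun j => Limits.Pi.map_π (fun i' => (P' i').proj j) i'
            comm_δ := fun i j h => hδ i j h i' },
    fun j => ⟨productIsProduct _⟩, fun j => ⟨productIsProduct _⟩⟩

/-- The complex of a product of towers is the product of their complexes, hence isomorphic to `K`.
-/
lemma WeightStructure.productsOfWeightComplexes {w : WeightStructure C} [HasProducts.{v} C]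
    (hge : ClosedUnderSmallProducts w.ge) (hle : ClosedUnderSmallProducts w.le) :
    w.ProductsOfWeightComplexes := by
  rintro I M M' f K K' π ⟨hf⟩ ⟨hπ⟩ hK'
  choose P' hP' e using hK'
  obtain ⟨P, ρ, hY, hG⟩ := TowerData.exists_product hf P'
  have hP := w.productsOfWeightTowers hge hle I M M' f P P' ρ ⟨hf⟩ hY hG hP'
  obtain ⟨hc⟩ := TowerData.nonempty_isLimit_complex ρ hG hP.postnikov fun i => (hP' i).postnikov
  refine ⟨P, hP, ⟨IsLimit.conePointsIsoOfNatIso hπ hc (Discrete.natIso fun i => (e i.as).some)⟩⟩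

end Products

/-! ### Weight towers and weight complexes. -/

namespace WeightStructure

variable {C : Type u} [Category.{v} C] [Preadditive C] [HasZeroObject C] [HasShift C ℤ]
  [∀ n : ℤ, (shiftFunctor C n).Additive] [Pretriangulated C] (w : WeightStructure C)

instance : w.le.IsStableUnderRetracts := w.le_retract

instance : w.ge.IsStableUnderRetracts := w.ge_retract

lemma translate_retract (Q : ObjectProperty C) [Q.IsStableUnderRetracts] (n : ℤ) :
    (translate Q n).IsStableUnderRetracts where
  of_retract ρ h := by
    rw [translate_iff] at h ⊢
    exact Q.prop_of_retract (ρ.map (shiftFunctor C (-n))) h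

lemma translate_translate_iff (Q : ObjectProperty C) [Q.IsClosedUnderIsomorphisms] (a b c : ℤ)
    (h : b + a = c) (X : C) : translate Q c (X⟦a⟧) ↔ translate Q b X := by
  rw [translate_iff, translate_iff]
  exact Q.prop_iff_of_iso ((shiftFunctorAdd' C a (-c) (-b) (by omega)).app X).symm

lemma leN_shift_iff (a b c : ℤ) (h : b + a = c) (X : C) : w.leN c (X⟦a⟧) ↔ w.leN b X :=
  translate_translate_iff w.le a b c h X

lemma geN_shift_iff (a b c : ℤ) (h : b + a = c) (X : C) : w.geN c (X⟦a⟧) ↔ w.geN b X :=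
  translate_translate_iff w.ge a b c h X

instance (n : ℤ) : (w.leN n).IsStableUnderRetracts := translate_retract w.le n

instance (n : ℤ) : (w.geN n).IsStableUnderRetracts := translate_retract w.ge n

lemma leN_zero : w.leN 0 = w.le := by
  ext X
  rw [leN, translate_iff]
  exact w.le.prop_iff_of_iso ((shiftFunctorZero' C _ (by simp)).app X)

lemma geN_zero : w.geN 0 = w.ge := by
  ext X
  rw [geN, translate_iff]
  exact w.ge.prop_iff_of_iso ((shiftFunctorZero' C _ (by simp)).app X)

lemma geN_succ_le (n : ℤ) : w.geN (n + 1) ≤ w.geN n := by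
  intro X hX
  rw [← w.geN_shift_iff (-n) n 0 (by omega), geN_zero]
  rw [← w.geN_shift_iff (-n) (n + 1) 1 (by omega)] at hX
  exact w.translate_ge _ hX

lemma geN_antitone {m n : ℤ} (h : m ≤ n) : w.geN n ≤ w.geN m := by
  obtain ⟨k, rfl⟩ := Int.le.dest h
  induction k with
  | zero => simp
  | succ k ih =>
    refine le_trans ?_ (ih (by omega))
    rw [Nat.cast_succ, ← add_assoc]
    exact w.geN_succ_le _

lemma orthogonalN {m n : ℤ} (h : m < n) {X Y : C} (hX : w.leN m X) (hY : w.geN n Y)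
    (f : X ⟶ Y) : f = 0 := by
  apply (shiftFunctor C (-m)).map_injective
  rw [Functor.map_zero]
  rw [← w.leN_shift_iff (-m) m 0 (by omega), leN_zero] at hX
  refine w.orthogonal hX (w.geN_antitone (show 1 ≤ n - m by omega) _ ?_) _
  rwa [w.geN_shift_iff (-m) n (n - m) (by omega)]

lemma exists_isDecomposition (n : ℤ) (M : C) :
    ∃ (B A : C) (b : B ⟶ M) (a : M ⟶ A) (f : A ⟶ B⟦(1 : ℤ)⟧),
      w.IsDecomposition n (Triangle.mk b a f) := by
  obtain ⟨B, A, b, a, f, hT, hB, hA⟩ := w.exists_decomposition (M⟦-n⟧)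
  obtain ⟨k, hk⟩ := shift_distinguished_mk hT n
  refine ⟨_, _, _, _, _, distinguished_of_iso₂ hk (shiftNegShift M n), ?_, ?_⟩
  · change w.leN n (B⟦n⟧)
    rwa [w.leN_shift_iff n 0 n (by omega), leN_zero]
  · change w.geN (n + 1) (A⟦n⟧)
    rwa [w.geN_shift_iff n 1 (n + 1) (by omega)]

/-- The map `X ⟶ A` of a decomposition vanishes, so `X` is a retract of its first term. -/
lemma leN_of_orthogonal {n : ℤ} {X : C} (h : ∀ Y, w.geN (n + 1) Y → ∀ f : X ⟶ Y, f = 0) :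
    w.leN n X := by
  obtain ⟨B, A, b, a, f, hT⟩ := w.exists_isDecomposition n X
  obtain ⟨s, hs⟩ := exists_fiber_factor hT.dist (𝟙 X) (by rw [h A hT.ge a, comp_zero])
  exact (w.leN n).prop_of_retract ⟨s, b, hs⟩ hT.le

lemma geN_of_orthogonal {n : ℤ} {Y : C} (h : ∀ X, w.leN (n - 1) X → ∀ f : X ⟶ Y, f = 0) :
    w.geN n Y := by
  obtain ⟨B, A, b, a, f, hT⟩ := w.exists_isDecomposition (n - 1) Y
  obtain ⟨s, hs⟩ := exists_cone_factor hT.dist (𝟙 Y) (by rw [h B hT.le b, zero_comp])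
  have hA := hT.ge
  rw [sub_add_cancel] at hA
  exact (w.geN n).prop_of_retract ⟨a, s, hs⟩ hA

/-- Decompositions chosen independently for all `n` are linked by orthogonality: `Y j ⟶ M ⟶ A i`
vanishes for `j < i + 1`. -/
lemma exists_isWeightTower (M : C) : ∃ P : TowerData M, w.IsWeightTower P := by
  choose Y A b a f hT using fun n => w.exists_isDecomposition n M
  choose map hmap using fun (j i : ℤ) (h : j + 1 = i) =>
    exists_fiber_factor (hT i).dist (b j) (w.orthogonalN (by omega) (hT j).le (hT i).ge _)
  choose G proj δ hG using fun i : ℤ => distinguished_cocone_triangle (map (i - 1) i (by omega))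
  let δ' (i j : ℤ) (h : j + 1 = i) : G i ⟶ (Y j)⟦(1 : ℤ)⟧ :=
    δ i ≫ eqToHom (by rw [show i - 1 = j by omega])
  refine ⟨⟨Y, G, b, map, proj, δ'⟩, ⟨hmap, ?_⟩, fun j => ⟨_, _, _, hT j⟩⟩
  intro j i hi
  obtain rfl : j = i - 1 := by omega
  have h : δ' i (i - 1) hi = δ i := by simp [δ']
  change Triangle.mk (map (i - 1) i hi) (proj i) (δ' i (i - 1) hi) ∈ distTriang C
  rw [h]
  exact hG i

lemma exists_isWeightComplex (M : C) : ∃ K, w.IsWeightComplex M K := by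
  obtain ⟨P, hP⟩ := w.exists_isWeightTower M
  exact ⟨_, P, hP, ⟨Iso.refl _⟩⟩

variable {w}

lemma IsWeightTower.leN {M : C} {P : TowerData M} (hP : w.IsWeightTower P) (j : ℤ) :
    w.leN j (P.Y j) := by
  obtain ⟨A, a, f, h⟩ := hP.decomposition j
  exact h.le

lemma IsWeightTower.leN_G {M : C} {P : TowerData M} (hP : w.IsWeightTower P) (i : ℤ) :
    w.leN i (P.G i) := by
  refine w.leN_of_orthogonal fun Z hZ f => ?_
  have hT := hP.postnikov.dist (i - 1) i (by omega)
  obtain ⟨l, rfl⟩ := exists_connecting_factor hT f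
    (w.orthogonalN (by omega) (hP.leN i) hZ _)
  rw [w.orthogonalN (by omega) ((w.leN_shift_iff 1 (i - 1) i (by omega) _).2 (hP.leN (i - 1)))
    hZ l, comp_zero]

/-- Morally `G i` is the fibre of `A (i - 1) ⟶ A i`, whose terms have weights at least `i` and `i +
1`. A diagram chase with test objects replaces the octahedral axiom. -/
lemma IsWeightTower.geN_G {M : C} {P : TowerData M} (hP : w.IsWeightTower P) (i : ℤ) :
    w.geN i (P.G i) := by
  refine w.geN_of_orthogonal fun X hX f => ?_
  have hi : i - 1 + 1 = i := by omega
  have hT := hP.postnikov.dist (i - 1) i hi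
  obtain ⟨A, a, k, hA⟩ := hP.decomposition i
  obtain ⟨A', a', k', hA'⟩ := hP.decomposition (i - 1)
  have hgeA := hA.ge
  have hgeA' := hA'.ge
  change w.geN (i + 1) A at hgeA
  change w.geN (i - 1 + 1) A' at hgeA'
  have h0 : (f ≫ P.δ i (i - 1) hi) ≫ (P.toObj (i - 1))⟦(1 : ℤ)⟧' = 0 := by
    have : P.δ i (i - 1) hi ≫ (P.map (i - 1) i hi)⟦(1 : ℤ)⟧' = 0 :=
      comp_distTriang_mor_zero₃₁ _ hT
    rw [← hP.postnikov.comm (i - 1) i hi, Functor.map_comp, Category.assoc,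
      ← Category.assoc (P.δ i (i - 1) hi), this, zero_comp, comp_zero]
  obtain ⟨g, hg⟩ := exists_lift_of_comp_connecting (rot_mk hA'.dist) (f ≫ P.δ i (i - 1) hi)
    (by rw [Preadditive.comp_neg, h0, neg_zero])
  rw [w.orthogonalN (by omega) hX hgeA' g, zero_comp] at hg
  obtain ⟨f', rfl⟩ := exists_lift_of_comp_connecting hT f hg.symm
  obtain ⟨f'', hf''⟩ := exists_fiber_factor hA'.dist (f' ≫ P.toObj i)
    (w.orthogonalN (by omega) hX hgeA' _)
  obtain ⟨x, y, hx⟩ := inv_rot_mk hA.dist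
  obtain ⟨z, hz⟩ := exists_fiber_factor hx (f' - f'' ≫ P.map (i - 1) i hi) (by
    rw [Preadditive.sub_comp, Category.assoc, hP.postnikov.comm, hf'', sub_self])
  rw [w.orthogonalN (by omega) hX ((w.geN_shift_iff (-1) (i + 1) i (by omega) A).2 hgeA) z,
    zero_comp] at hz
  have h1 : P.map (i - 1) i hi ≫ P.proj i = 0 := comp_distTriang_mor_zero₁₂ _ hT
  rw [sub_eq_zero.1 hz.symm, Category.assoc, h1, comp_zero]

instance : w.heart.IsStableUnderRetracts where
  of_retract ρ h := ⟨w.ge.prop_of_retract ρ h.1, w.le.prop_of_retract ρ h.2⟩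

/-- The terms of a weight complex belong to the heart. -/
lemma IsWeightComplex.heart_X {M : C} {K : CochainComplex C ℤ} (hK : w.IsWeightComplex M K)
    (p : ℤ) : w.heart (K.X p) := by
  obtain ⟨P, hP, ⟨e⟩⟩ := hK
  have h : w.heart ((P.G (-p))⟦p⟧) := by
    constructor
    · rw [← geN_zero, w.geN_shift_iff p (-p) 0 (by omega)]
      exact hP.geN_G _
    · rw [← leN_zero, w.leN_shift_iff p (-p) 0 (by omega)]
      exact hP.leN_G _
  exact w.heart.prop_of_iso ((HomologicalComplex.eval C _ p).mapIso e).symm h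

/-- An object of nonnegative weight has a weight decomposition whose first term is a retract of the
zeroth term of a given weight complex. -/
lemma IsWeightComplex.exists_approximation {M : C} {K : CochainComplex C ℤ}
    (hK : w.IsWeightComplex M K) (hM : w.ge M) :
    ∃ (B A : C) (b : B ⟶ M) (a : M ⟶ A) (f : A ⟶ B⟦(1 : ℤ)⟧),
      Triangle.mk b a f ∈ distTriang C ∧ Nonempty (Retract B (K.X 0)) ∧ translate w.ge 1 A := by
  obtain ⟨P, hP, ⟨e⟩⟩ := hK
  obtain ⟨A, a, f, hA⟩ := hP.decomposition 0
  have hge : w.geN 1 A := hA.ge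
  refine ⟨_, _, _, _, _, hA.dist, ?_, hge⟩
  have hT := hP.postnikov.dist (-1) 0 (by omega)
  -- `Y (-1) ⟶ M` vanishes, so this map factors through `A⟦-1⟧`, of weight at least 0, and vanishes
  -- too. Hence `P.proj 0` is a split monomorphism.
  have h0 : P.map (-1) 0 (by omega) = 0 := by
    obtain ⟨x, y, hx⟩ := inv_rot_mk hA.dist
    rw [← geN_zero] at hM
    obtain ⟨z, hz⟩ := exists_fiber_factor hx (P.map (-1) 0 (by omega))
      (w.orthogonalN (by omega) (hP.leN (-1)) hM _)
    rw [← hz, w.orthogonalN (by omega) (hP.leN (-1))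
      ((w.geN_shift_iff (-1) 1 0 (by omega) A).2 hge) z, zero_comp]
  obtain ⟨r, hr⟩ : ∃ r : P.G 0 ⟶ P.Y 0, P.proj 0 ≫ r = 𝟙 _ :=
    exists_cone_factor hT (𝟙 (P.Y 0)) (by rw [h0, zero_comp])
  have e' : P.G 0 ≅ K.X 0 := eqToIso (by simp) ≪≫ ((shiftFunctorZero C ℤ).app (P.G (-0))).symm ≪≫
    ((HomologicalComplex.eval C _ 0).mapIso e).symm
  exact ⟨⟨P.proj 0 ≫ e'.hom, e'.inv ≫ r, by simpa using hr⟩⟩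

lemma heart_closedUnderSmallProducts (hle : ClosedUnderSmallProducts w.le)
    (hge : ClosedUnderSmallProducts w.ge) : ClosedUnderSmallProducts w.heart :=
  hge.inf hle

end WeightStructure

lemma ClosedUnderSmallProducts.prop_of_isZero {C : Type u} [Category.{v} C] [HasZeroMorphisms C]
    {Q : ObjectProperty C} (hQ : ClosedUnderSmallProducts Q) {X : C} (hX : IsZero X) : Q X :=
  hQ.fan (I := PEmpty) (Y := PEmpty.elim) (c := Fan.mk X fun i => i.elim)
    (Fan.IsLimit.mk _ (fun _ => 0) (fun _ i => i.elim) fun _ _ _ => hX.eq_of_tgt _ _)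
    fun i => i.elim

lemma ClosedUnderSmallProducts.prop_biprod {C : Type u} [Category.{v} C] [HasZeroMorphisms C]
    {Q : ObjectProperty C} (hQ : ClosedUnderSmallProducts Q) {X Y : C} [HasBinaryBiproduct X Y]
    (hX : Q X) (hY : Q Y) : Q (X ⊞ Y) := by
  have h := hQ.fan (I := ULift.{v} Bool) (Y := fun i => if i.down then X else Y)
    (c := Fan.mk (X ⊞ Y) fun ⟨b⟩ => match b with | true => biprod.fst | false => biprod.snd)
    (Fan.IsLimit.mk _ (fun s => biprod.lift (s.proj ⟨true⟩) (s.proj ⟨false⟩))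
      (by rintro s ⟨_ | _⟩ <;> simp [Fan.proj])
      (fun s m hm => by
        refine biprod.hom_ext _ _ ?_ ?_
        · rw [biprod.lift_fst, ← hm]; rfl
        · rw [biprod.lift_snd, ← hm]; rfl))
    (by rintro ⟨_ | _⟩ <;> simpa)
  exact h

/-! ### Approximation of objects of nonnegative weight. -/

namespace WeightStructure

variable {C : Type u} [Category.{v} C] [Preadditive C] [HasZeroObject C] [HasShift C ℤ]
  [∀ n : ℤ, (shiftFunctor C n).Additive] [Pretriangulated C] (w : WeightStructure C)

lemma geN_isCoenvelopeClosed (hge : IsCoenvelopeClosed w.ge) (n : ℤ) :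
    IsCoenvelopeClosed (w.geN n) := by
  have h : w.geN n = w.ge.shift (-n) := by
    ext X
    exact translate_iff w.ge n X
  rw [h]
  exact hge.shift (-n)

/-- A distinguished triangle `B ⟶ M ⟶ A ⟶ B⟦1⟧` with `B` in `H` and `A` of weight at least `1`. -/
structure Approximation (H : ObjectProperty C) (M : C) where
  B : C
  A : C
  b : B ⟶ M
  a : M ⟶ A
  f : A ⟶ B⟦(1 : ℤ)⟧
  dist : Triangle.mk b a f ∈ distTriang C
  prop_B : H B
  ge_A : w.geN 1 A

variable {w} {H : ObjectProperty C}

lemma retract_of_distinguished {U V W : C} {p : U ⟶ V} {q : V ⟶ W} {r : W ⟶ U⟦(1 : ℤ)⟧}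
    (hT : Triangle.mk p q r ∈ distTriang C) (hr : r = 0) : Nonempty (Retract U V) := by
  obtain ⟨e, he, -⟩ := exists_iso_binaryBiproduct_of_distTriang _ hT hr
  have h : (p ≫ e.hom : U ⟶ U ⊞ W) ≫ biprod.fst = 𝟙 U := by
    rw [show (p ≫ e.hom : U ⟶ U ⊞ W) = biprod.inl from he, biprod.inl_fst]
  exact ⟨⟨p, (show V ≅ U ⊞ W from e).hom ≫ biprod.fst, (Category.assoc _ _ _).symm.trans h⟩⟩

/-- The connecting map `V ⟶ E⟦1⟧` is zero by orthogonality, so `U` is the biproduct of `E` and `V`.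
-/
lemma prop_fiber_of_heart [H.IsStableUnderRetracts] (hH : H ≤ w.heart)
    (hprod : ClosedUnderSmallProducts H) {U V E : C} {p : U ⟶ V} {q : V ⟶ E⟦(1 : ℤ)⟧}
    {r : E⟦(1 : ℤ)⟧ ⟶ U⟦(1 : ℤ)⟧} (hT : Triangle.mk p q r ∈ distTriang C) (hV : H V) (hE : H E) :
    H U := by
  obtain ⟨x, l, hx⟩ := inv_rot_mk hT
  have hE' : H (E⟦(1 : ℤ)⟧⟦(-1 : ℤ)⟧) := H.prop_of_iso (shiftShiftNeg E (1 : ℤ)).symm hE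
  have hl : l = 0 := w.orthogonalN (show (0 : ℤ) < 1 by omega)
    (by rw [leN_zero]; exact (hH _ hV).2)
    ((w.geN_shift_iff 1 0 1 (by omega) _).2 (by rw [geN_zero]; exact (hH _ hE').1)) l
  obtain ⟨e, -⟩ := exists_iso_binaryBiproduct_of_distTriang _ hx hl
  exact H.prop_of_iso e.symm (hprod.prop_biprod hE' hV)

/-- Shifting `D₀` approximates `Z` by `D₀.B⟦1⟧`, with complement of weight at least 2. Orthogonality
extends `Y ⟶ Z` to the complements, and the fibres in the `3 × 3` diagram approximate `Y'`. -/
lemma Approximation.exists_next [IsTriangulated C] [HasProducts.{v} C]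
    [H.IsStableUnderRetracts] (hH : H ≤ w.heart)
    (hprod : ClosedUnderSmallProducts H) (hge : IsCoenvelopeClosed w.ge)
    {Y Y' Z : C} {φ : Y' ⟶ Y} {g : Y ⟶ Z} {h : Z ⟶ Y'⟦(1 : ℤ)⟧}
    (hT : Triangle.mk φ g h ∈ distTriang C) (D : w.Approximation H Y)
    (D₀ : w.Approximation H (Z⟦(-1 : ℤ)⟧)) :
    ∃ (D' : w.Approximation H Y') (ψ : D'.A ⟶ D.A), φ ≫ D.a = D'.a ≫ ψ ∧
      ∃ (W : C) (i : W ⟶ D'.A) (k : D.A ⟶ W⟦(1 : ℤ)⟧), Triangle.mk i ψ k ∈ distTriang C ∧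
        w.geN 1 W := by
  have : HasProducts.{0} C := has_smallest_products_of_hasProducts.{v}
  obtain ⟨k, hk⟩ := shift_distinguished_mk D₀.dist 1
  have hk' := distinguished_of_iso₂ hk (shiftNegShift Z (1 : ℤ))
  have hA : w.geN 2 (D₀.A⟦(1 : ℤ)⟧) := (w.geN_shift_iff 1 1 2 (by omega) _).2 D₀.ge_A
  have hB : w.leN 0 D.B := by
    rw [leN_zero]
    exact (hH _ D.prop_B).2
  obtain ⟨χ, hχ⟩ := exists_cone_factor D.dist
    (g ≫ (shiftNegShift Z (1 : ℤ)).inv ≫ D₀.a⟦(1 : ℤ)⟧')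
    (w.orthogonalN (by omega) hB hA _)
  obtain ⟨A', ψ, κ, hψ⟩ := distinguished_cocone_triangle₁ χ
  obtain ⟨U, a₀, u, j, p, q, r, comm, hU, hp⟩ := exists_fiber_triangle hT hψ D.dist hk' hχ.symm
  obtain ⟨i, l, hi⟩ := inv_rot_mk hψ
  have hW : w.geN 1 (D₀.A⟦(1 : ℤ)⟧⟦(-1 : ℤ)⟧) := (w.geN_shift_iff (-1) 2 1 (by omega) _).2 hA
  refine ⟨⟨U, A', a₀, u, j, hU, prop_fiber_of_heart hH hprod hp D.prop_B D₀.prop_B, ?_⟩, ψ, comm,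
    _, i, l, hi, hW⟩
  exact (w.geN_isCoenvelopeClosed hge 1).ext _ hi hW D.ge_A

open scoped ZeroObject in
-- For a homotopy limit `X`, let `F` be the product of the terms `B` and `N` the homotopy limit of
-- the terms `A`. The fibre `U` of `X ⟶ N` lies in a triangle `U ⟶ F ⟶ F`. As `X` has nonnegative
-- weight, so does `U`; thus `F ⟶ U⟦1⟧` is zero and `U` is a retract of `F`.
lemma approximable_isCoenvelopeClosed [IsTriangulated C] [HasProducts.{v} C]
    [H.IsStableUnderRetracts] (hH : H ≤ w.heart)
    (hprod : ClosedUnderSmallProducts H) (hge : IsCoenvelopeClosed w.ge) :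
    IsCoenvelopeClosed (fun M => w.ge M ∧ Nonempty (w.Approximation H M)) where
  zero X hX := ⟨hge.zero X hX, ⟨⟨X, 0, 𝟙 X, 0, 0, contractible_distinguished X,
    hprod.prop_of_isZero hX, (w.geN_isCoenvelopeClosed hge 1).zero _ (isZero_zero C)⟩⟩⟩
  prod := .of_fan fun I Y c hc h => by
    refine ⟨hge.prod.fan hc fun i => (h i).1, ?_⟩
    let D (i : I) : w.Approximation H (Y i) := (h i).2.some
    obtain ⟨v, hv⟩ := exists_fan_lift (productIsProduct fun i => (D i).A)
      (fun i => c.proj i ≫ (D i).a)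
    obtain ⟨F, b, k, hF⟩ := distinguished_cocone_triangle₁ v
    obtain ⟨e⟩ := nonempty_iso_pi_fiber
      (T' := fun i => Triangle.mk (D i).b (D i).a (D i).f) (fun i => (D i).dist) hc
      (productIsProduct fun i => (D i).A) hv hF
    exact ⟨⟨F, _, b, v, k, hF, H.prop_of_iso e.symm (hprod.pi _ fun i => (D i).prop_B),
      (w.geN_isCoenvelopeClosed hge 1).prod.pi _ fun i => (D i).ge_A⟩⟩
  holim Y φ h0 h X hX := by
    have : HasProducts.{0} C := has_smallest_products_of_hasProducts.{v}
    have hgeX : w.ge X := hge.holim Y φ h0.1 (fun i => by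
      obtain ⟨Z, g, k, hT, hZ⟩ := h i
      exact ⟨Z, g, k, hT, hZ.1⟩) X hX
    refine ⟨hgeX, ?_⟩
    have next (i : ℕ) (D : w.Approximation H (Y i)) : ∃ (D' : w.Approximation H (Y (i + 1)))
        (ψ : D'.A ⟶ D.A), φ i ≫ D.a = D'.a ≫ ψ ∧
        ∃ (W : C) (i : W ⟶ D'.A) (k : D.A ⟶ W⟦(1 : ℤ)⟧), Triangle.mk i ψ k ∈ distTriang C ∧
          w.geN 1 W := by
      obtain ⟨Z, g, k, hT, hZ⟩ := h i
      exact Approximation.exists_next hH hprod hge hT D hZ.2.some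
    choose s hs using next
    obtain ⟨D, -, hD⟩ := exists_seq (α := fun i => w.Approximation H (Y i)) h0.2.some s
    have hs' (i : ℕ) : ∃ (ψ : (D (i + 1)).A ⟶ (D i).A), φ i ≫ (D i).a = (D (i + 1)).a ≫ ψ ∧
        ∃ (W : C) (j : W ⟶ (D (i + 1)).A) (k : (D i).A ⟶ W⟦(1 : ℤ)⟧),
          Triangle.mk j ψ k ∈ distTriang C ∧ w.geN 1 W := by
      rw [hD]
      exact hs i (D i)
    choose ψ hψ hfib using hs'
    obtain ⟨c, hc, f, d, k, hd, hT⟩ := hX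
    have hcA := productIsProduct fun i => (D i).A
    obtain ⟨d', hd'⟩ := exists_id_sub_shift ψ hcA
    obtain ⟨N, f', k', hN⟩ := distinguished_cocone_triangle₁ d'
    have hgeN : w.geN 1 N := (w.geN_isCoenvelopeClosed hge 1).holim_of_fibers (D 0).ge_A hfib
      ⟨_, hcA, f', d', k', hd', hN⟩
    obtain ⟨v, hv⟩ := exists_fan_lift hcA (fun i => c.proj i ≫ (D i).a)
    obtain ⟨F, b, l, hF⟩ := distinguished_cocone_triangle₁ v
    obtain ⟨e⟩ := nonempty_iso_pi_fiber
      (T' := fun i => Triangle.mk (D i).b (D i).a (D i).f) (fun i => (D i).dist) hc hcA hv hF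
    have := hprod.nat
    have hHF : H F := H.prop_of_iso e.symm (H.prop_pi _ fun i => (D i).prop_B)
    have comm : d ≫ v = v ≫ d' := fan_hom_ext hcA fun i => by
      rw [Category.assoc, Category.assoc, hv, hd', Preadditive.comp_sub, ← Category.assoc, hd,
        ← Category.assoc, hv, hv, Preadditive.sub_comp, Category.assoc, hψ, Category.assoc]
    obtain ⟨U, a₀, u, j, p, q, r, -, hU, hp⟩ := exists_fiber_triangle hT hN hF hF comm
    obtain ⟨x, y, hx⟩ := inv_rot_mk hU
    have hgeU : w.ge U := hge.ext _ hx (by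
      rw [← geN_zero]
      exact (w.geN_shift_iff (-1) 1 0 (by omega) N).2 hgeN) hgeX
    obtain ⟨ρ⟩ := retract_of_distinguished hp (w.orthogonalN (show (0 : ℤ) < 1 by omega)
      (by rw [leN_zero]; exact (hH _ hHF).2)
      ((w.geN_shift_iff 1 0 1 (by omega) U).2 (by rwa [geN_zero])) r)
    exact ⟨⟨U, N, a₀, u, j, hU, H.prop_of_retract ρ hHF, hgeN⟩⟩

/-- A class of objects of the heart that is closed under small products and retracts contains the
heart as soon as the generators can be approximated by its objects. -/
lemma heart_le_of_approximation [IsTriangulated C] [HasProducts.{v} C]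
    [H.IsStableUnderRetracts] (hH : H ≤ w.heart) (hprod : ClosedUnderSmallProducts H)
    {S : ObjectProperty C} (hge : w.ge = coenvelope S)
    (hS : ∀ X, S X → Nonempty (w.Approximation H X)) : w.heart ≤ H := by
  have hge' : IsCoenvelopeClosed w.ge := hge ▸ coenvelope_isCoenvelopeClosed S
  rintro M ⟨hM, hM'⟩
  obtain ⟨D⟩ := (coenvelope_le (approximable_isCoenvelopeClosed hH hprod hge')
    (fun X hX => ⟨hge ▸ le_coenvelope S X hX, hS X hX⟩) M (hge ▸ hM)).2
  obtain ⟨s, hs⟩ := exists_fiber_factor D.dist (𝟙 M)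
    (w.orthogonalN (show (0 : ℤ) < 1 by omega) (by rwa [leN_zero]) D.ge_A _)
  exact H.prop_of_retract ⟨s, D.b, hs⟩ D.prop_B

end WeightStructure

/-! ### Products of products and of retracts. -/

section Products

variable {D : Type u} [Category.{v} D]

lemma smallProducts_iff (T : ObjectProperty D) (X : D) :
    smallProducts T X ↔ ∃ (I : Type v) (F : I → D) (p : ∀ i, X ⟶ F i),
      Nonempty (IsLimit (Fan.mk X p)) ∧ ∀ i, T (F i) := by
  constructor
  · rintro ⟨I, ⟨h⟩⟩
    refine ⟨I, fun i => h.diag.obj ⟨i⟩, fun i => h.π.app ⟨i⟩, ⟨?_⟩, fun i => h.prop_diag_obj ⟨i⟩⟩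
    let e := Discrete.natIsoFunctor (F := h.diag)
    exact ((IsLimit.postcomposeHomEquiv e _).symm h.isLimit).ofIsoLimit
      (Cone.ext (Iso.refl _) fun ⟨i⟩ => by simp [e])
  · rintro ⟨I, F, p, ⟨hp⟩, hF⟩
    exact ⟨I, ⟨⟨⟨Discrete.functor F, (Fan.mk X p).π, hp⟩, fun i => hF i.as⟩⟩⟩

lemma le_smallProducts (T : ObjectProperty D) : T ≤ smallProducts T := by
  intro X hX
  refine (smallProducts_iff T X).2 ⟨PUnit, fun _ => X, fun _ => 𝟙 X, ⟨?_⟩, fun _ => hX⟩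
  exact Fan.IsLimit.mk _ (fun s => s.proj ⟨⟩) (fun s i => by simp [Fan.proj])
    (fun s m hm => by rw [← hm ⟨⟩]; simp [Fan.proj])

lemma smallProducts_closedUnderSmallProducts (T : ObjectProperty D) :
    ClosedUnderSmallProducts (smallProducts T) := .of_fan fun I Y c hc h => by
  simp only [smallProducts_iff] at h ⊢
  choose J F p hp hF using h
  let p' (k : Σ i, J i) : c.pt ⟶ F k.1 k.2 := c.proj k.1 ≫ p k.1 k.2
  have hex {X : D} (f : ∀ k : Σ i, J i, X ⟶ F k.1 k.2) : ∃ g : X ⟶ c.pt, ∀ k, g ≫ p' k = f k := by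
    choose g hg using fun i => exists_fan_lift (hp i).some (fun j => f ⟨i, j⟩)
    obtain ⟨l, hl⟩ := exists_fan_lift hc g
    refine ⟨l, fun k => ?_⟩
    rw [← Category.assoc, hl]
    exact hg k.1 k.2
  refine ⟨Σ i, J i, fun k => F k.1 k.2, p', ⟨?_⟩, fun k => hF k.1 k.2⟩
  refine Fan.IsLimit.mk _ (fun s => (hex s.proj).choose) (fun s => (hex s.proj).choose_spec)
    fun s m hm => fan_hom_ext hc fun i => fan_hom_ext (hp i).some fun j => ?_
  rw [Category.assoc, Category.assoc]
  exact (hm ⟨i, j⟩).trans ((hex s.proj).choose_spec ⟨i, j⟩).symm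

lemma smallProducts_le {T Q : ObjectProperty D} (hQ : ClosedUnderSmallProducts Q) (h : T ≤ Q) :
    smallProducts T ≤ Q := by
  intro X hX
  obtain ⟨I, F, p, ⟨hp⟩, hF⟩ := (smallProducts_iff T X).1 hX
  exact hQ.fan hp fun i => h _ (hF i)

/-- A product of retracts is a retract. -/
lemma nonempty_retract_of_fans {I : Type*} {X Y : I → D} {c : Fan X} {c' : Fan Y} (hc : IsLimit c)
    (hc' : IsLimit c') (ρ : ∀ i, Retract (X i) (Y i)) : Nonempty (Retract c.pt c'.pt) := by
  obtain ⟨i, hi⟩ := exists_fan_lift hc' fun i => c.proj i ≫ (ρ i).i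
  obtain ⟨r, hr⟩ := exists_fan_lift hc fun i => c'.proj i ≫ (ρ i).r
  exact ⟨⟨i, r, fan_hom_ext hc fun j => by
    rw [Category.assoc, hr, ← Category.assoc, hi, Category.assoc, (ρ j).retract]; simp⟩⟩

end Products

/-! ### Recognition of Karoubi envelopes. -/

section Karoubi

variable {D : Type*} [Category* D]

/-- If every object of an idempotent complete category `D` is a retract of an object in the image
of a fully faithful functor `J`, then `D` is the Karoubi envelope of the source of `J`. -/
lemma exists_karoubi_equivalence {A : Type*} [Category* A] [IsIdempotentComplete D] (J : A ⥤ D)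
    [J.Full] [J.Faithful] (hJ : ∀ X : D, ∃ Y : A, Nonempty (Retract X (J.obj Y))) :
    ∃ e : Idempotents.Karoubi A ≌ D, Nonempty (Idempotents.toKaroubi A ⋙ e.functor ≅ J) := by
  let F := (Idempotents.functorExtension₂ A D).obj J
  have h₁ : F.Faithful := ⟨fun {P Q f g} h => by
    ext
    exact J.map_injective (congrArg Idempotents.Karoubi.Hom.f h)⟩
  have h₂ : F.Full := ⟨fun {P Q} g => by
    obtain ⟨f, hf⟩ := J.map_surjective g.f
    refine ⟨⟨f, J.map_injective ?_⟩, Idempotents.Karoubi.hom_ext _ _ hf⟩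
    rw [J.map_comp, J.map_comp, hf]
    exact g.comm⟩
  have h₃ : F.EssSurj := ⟨fun Z => by
    obtain ⟨Y, ⟨ρ⟩⟩ := hJ Z.X
    -- The idempotent of `Z`, transported along the retraction to `J.obj Y`, comes from an
    -- idempotent of `Y`.
    obtain ⟨p, hp⟩ := J.map_surjective (ρ.r ≫ Z.p ≫ ρ.i)
    have hpp : p ≫ p = p := J.map_injective (by rw [J.map_comp, hp]; simp)
    have hr : J.map p ≫ (ρ.r ≫ Z.p) ≫ Z.p = ρ.r ≫ Z.p := by rw [hp]; simp
    have hi : Z.p ≫ (Z.p ≫ ρ.i) ≫ J.map p = Z.p ≫ ρ.i := by rw [hp]; simp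
    have hri : (ρ.r ≫ Z.p) ≫ Z.p ≫ ρ.i = J.map p := by rw [hp]; simp
    have hir : (Z.p ≫ ρ.i) ≫ ρ.r ≫ Z.p = Z.p := by simp
    exact ⟨⟨Y, p, hpp⟩, ⟨⟨⟨ρ.r ≫ Z.p, hr⟩, ⟨Z.p ≫ ρ.i, hi⟩, Idempotents.Karoubi.hom_ext _ _ hri,
      Idempotents.Karoubi.hom_ext _ _ hir⟩⟩⟩⟩
  have h₄ : F.IsEquivalence := { }
  refine ⟨F.asEquivalence.trans (Idempotents.toKaroubiEquivalence D).symm, ⟨?_⟩⟩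
  exact (Functor.associator _ _ _).symm ≪≫ Functor.isoWhiskerRight
    ((Idempotents.functorExtension₂CompWhiskeringLeftToKaroubiIso A D).app J) _ ≪≫
    Functor.associator _ _ _ ≪≫
    Functor.isoWhiskerLeft J (Idempotents.toKaroubiEquivalence D).unitIso.symm ≪≫
    Functor.rightUnitor _

lemma exists_karoubi_equivalence_fullSubcategory {P Q : ObjectProperty D} (h : P ≤ Q)
    [IsIdempotentComplete Q.FullSubcategory] (hQ : Q ≤ P.retractClosure) :
    ∃ e : Idempotents.Karoubi P.FullSubcategory ≌ Q.FullSubcategory,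
      Nonempty (Idempotents.toKaroubi _ ⋙ e.functor ⋙ Q.ι ≅ P.ι) := by
  obtain ⟨e, ⟨α⟩⟩ := exists_karoubi_equivalence (ObjectProperty.ιOfLE h) fun X => by
    obtain ⟨Y, hY, ⟨ρ⟩⟩ := hQ X.obj X.property
    exact ⟨⟨Y, hY⟩, ⟨⟨Q.fullyFaithfulι.preimage ρ.i, Q.fullyFaithfulι.preimage ρ.r,
      Q.ι.map_injective (by
        rw [Functor.map_comp, Functor.FullyFaithful.map_preimage,
          Functor.FullyFaithful.map_preimage]
        exact ρ.retract)⟩⟩⟩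
  exact ⟨e, ⟨(Functor.associator _ _ _).symm ≪≫ Functor.isoWhiskerRight α Q.ι⟩⟩

end Karoubi

/-! ### The heart and the final assembly. -/

namespace WeightStructure

variable {C : Type u} [Category.{v} C] [Preadditive C] [HasZeroObject C] [HasShift C ℤ]
  [∀ n : ℤ, (shiftFunctor C n).Additive] [Pretriangulated C] [IsTriangulated C] [HasProducts.{v} C]

/-- Every object of the heart of a restricted weight structure is a retract of a product of terms
of weight complexes of the generators. -/
lemma heart_restrict_le_retractClosure {w : WeightStructure C} {S : ObjectProperty C}
    (hge : w.ge = coenvelope S) {P : ObjectProperty C} [P.IsTriangulated]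
    [P.IsClosedUnderIsomorphisms] (hP : ClosedUnderSmallProducts P) (h : w.ge ≤ P)
    (hheart : ClosedUnderSmallProducts (w.restrict P h).heart)
    {T : ObjectProperty P.FullSubcategory} (hT : T ≤ (w.restrict P h).heart)
    (happ : ∀ X : P.FullSubcategory, S X.obj →
      Nonempty ((w.restrict P h).Approximation T.retractClosure X)) :
    (w.restrict P h).heart ≤ (smallProducts T).retractClosure := by
  have := hP.hasProducts
  -- The coenvelope is formed in `C`, so the retracts of products are also taken in `C`.
  let H : ObjectProperty C := fun X =>
    ∃ Y : P.FullSubcategory, smallProducts T Y ∧ Nonempty (Retract X Y.obj)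
  have hH : H.IsStableUnderRetracts := ⟨fun ρ ⟨Y, hY, ⟨σ⟩⟩ => ⟨Y, hY, ⟨ρ.trans σ⟩⟩⟩
  have hHw : H ≤ w.heart := by
    rintro X ⟨Y, hY, ⟨ρ⟩⟩
    have h' := smallProducts_le hheart hT Y hY
    exact w.heart.prop_of_retract ρ ⟨h'.1, h'.2.1⟩
  have hHprod : ClosedUnderSmallProducts H := .of_fan fun I X c hc hX => by
    choose Y hY ρ using hX
    have := hP.preservesLimitsOfShape_ι I
    obtain ⟨hc'⟩ := nonempty_isLimit_map_fan P.ι (productIsProduct Y)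
    exact ⟨_, (smallProducts_closedUnderSmallProducts T).pi Y hY,
      nonempty_retract_of_fans hc hc' fun i => (ρ i).some⟩
  have key : w.heart ≤ H := heart_le_of_approximation hHw hHprod hge fun X hX => by
    obtain ⟨D⟩ := happ ⟨X, h _ (hge ▸ le_coenvelope S X hX)⟩ hX
    obtain ⟨k, hk⟩ := distinguished_map_ι P D.dist
    obtain ⟨Y, hY, ⟨ρ⟩⟩ := D.prop_B
    exact ⟨⟨D.B.obj, D.A.obj, D.b.hom, D.a.hom, k, hk,
      ⟨Y, le_smallProducts T Y hY, ⟨ρ.map P.ι⟩⟩, (translate_inverseImage_ι_iff P 1 _).1 D.ge_A⟩⟩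
  intro X hX
  obtain ⟨Y, hY, ⟨ρ⟩⟩ := key X.obj ⟨hX.1, hX.2.1⟩
  refine ⟨Y, hY, ⟨⟨P.fullyFaithfulι.preimage ρ.i, P.fullyFaithfulι.preimage ρ.r,
      P.ι.map_injective ?_⟩⟩⟩
  rw [Functor.map_comp, Functor.FullyFaithful.map_preimage, Functor.FullyFaithful.map_preimage]
  exact ρ.retract

end WeightStructure

variable {C : Type u} [Category.{v} C] [Preadditive C] [HasZeroObject C] [HasShift C ℤ]
  [∀ n : ℤ, (shiftFunctor C n).Additive] [Pretriangulated C] {S : ObjectProperty C}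

lemma cogen_isStableUnderRetracts [HasProducts.{v} C] (hshift : translate S 1 ≤ S.isoClosure) :
    (cogen S).IsStableUnderRetracts := by
  have := cogen_isTriangulated hshift
  have : HasProducts.{0} C := has_smallest_products_of_hasProducts.{v}
  exact (coenvelope_isCoenvelopeClosed (nonposShifts S)).isStableUnderRetracts
    fun X hX => (cogen S).le_shift 1 X hX

instance {P Q : ObjectProperty C} [P.IsStableUnderRetracts] [Q.IsStableUnderRetracts] :
    (P ⊓ Q).IsStableUnderRetracts where
  of_retract ρ h := ⟨P.prop_of_retract ρ h.1, Q.prop_of_retract ρ h.2⟩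

variable [IsTriangulated C] [HasProducts.{v} C]

lemma restrict_nonDegenerateFromBelow (hshift : translate S 1 ≤ S.isoClosure)
    [(cogen S).IsTriangulated] {w : WeightStructure C} (hle : w.le = classOne S)
    (h : w.ge ≤ cogen S) : (w.restrict (cogen S) h).NonDegenerateFromBelow := by
  have hi := cogen_isStableUnderRetracts hshift
  intro X
  constructor
  · intro hX
    have hX' : IsZero X.obj := isZero_of_forall_translate_classOne hshift X.property fun l => by
      have h1 := (translate_inverseImage_ι_iff (cogen S) (Q := w.le ⊓ cogen S) l X).1 (hX l)
      rw [translate_iff] at h1 ⊢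
      exact hle ▸ h1.1
    rw [IsZero.iff_id_eq_zero] at hX' ⊢
    ext
    exact hX'
  · intro hX l
    have h0 : (w.restrict (cogen S) h).le.IsStableUnderRetracts := inferInstance
    have h1 : IsZero (X⟦-l⟧) := (shiftFunctor (cogen S).FullSubcategory (-l)).map_isZero hX
    have h2 : IsZero (X⟦-l⟧).obj := (cogen S).ι.map_isZero h1
    rw [WeightStructure.leN, translate_iff]
    refine ⟨?_, (X⟦-l⟧).property⟩
    rw [hle]
    exact fun Y f _ => h2.eq_of_src _ _

end WeightStr

theorem theorem2p2p6
    {C : Type u} [Category.{v} C] [Preadditive C] [HasZeroObject C] [HasShift C ℤ]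
    [∀ n : ℤ, (shiftFunctor C n).Additive] [Pretriangulated C] [IsTriangulated C]
    [HasProducts.{v} C]
    (S : ObjectProperty C) [ObjectProperty.Small.{v} S]
    (hcocompact : ∀ X, S X → WeightStr.IsCocompact X)
    (hshift : WeightStr.translate S 1 ≤ S.isoClosure) :
    -- the weight structure on `C`
    (∃ w : WeightStr.WeightStructure C,
      w.le = WeightStr.classOne S ∧ w.ge = WeightStr.coenvelope S) ∧
    -- the subcategories `cogen S` and `perp S`
    (WeightStr.perp S).IsTriangulated ∧
    WeightStr.ClosedUnderSmallProducts (WeightStr.perp S) ∧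
    WeightStr.ClosedUnderSmallProducts (WeightStr.cogen S) ∧
    (∀ E : ObjectProperty C, E.IsTriangulated → E.IsClosedUnderIsomorphisms →
      WeightStr.ClosedUnderSmallProducts E → S ≤ E → WeightStr.cogen S ≤ E) ∧
    S ≤ WeightStr.cogen S ∧
    ∃ _ : (WeightStr.cogen S).IsTriangulated,
      -- the weight structure on `cogen S`
      WeightStr.coenvelope S ≤ WeightStr.cogen S ∧
      ∃ w : WeightStr.WeightStructure (WeightStr.cogen S).FullSubcategory,
        w.le = (WeightStr.classOne S ⊓ WeightStr.cogen S).inverseImage (WeightStr.cogen S).ι ∧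
        w.ge = (WeightStr.coenvelope S).inverseImage (WeightStr.cogen S).ι ∧
        w.NonDegenerateFromBelow ∧
        -- decomposition of the class `⊥(S[1])`
        WeightStr.classOne S = WeightStr.extensionClosure
          ((WeightStr.classOne S ⊓ WeightStr.cogen S) ⊔ WeightStr.perp S) ∧
        -- closure under products
        WeightStr.ClosedUnderSmallProducts (WeightStr.classOne S ⊓ WeightStr.cogen S) ∧
        WeightStr.ClosedUnderSmallProducts w.heart ∧
        w.ProductsOfDecompositions ∧
        w.ProductsOfWeightTowers ∧
        w.ProductsOfWeightComplexes ∧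
        -- idempotent completeness
        IsIdempotentComplete C ∧
        IsIdempotentComplete (WeightStr.cogen S).FullSubcategory ∧
        IsIdempotentComplete (WeightStr.classOne S).FullSubcategory ∧
        IsIdempotentComplete (WeightStr.classOne S ⊓ WeightStr.cogen S).FullSubcategory ∧
        IsIdempotentComplete (WeightStr.coenvelope S).FullSubcategory ∧
        -- description of the heart
        (∀ M, ∃ K, w.IsWeightComplex M K) ∧
        (∀ t : (c : (WeightStr.cogen S).FullSubcategory) → S c.obj →
            CochainComplex (WeightStr.cogen S).FullSubcategory ℤ,
          (∀ c hc, w.IsWeightComplex c (t c hc)) →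
          ∃ e : Idempotents.Karoubi (WeightStr.smallProducts
              (fun X => ∃ c hc, ∃ i : ℤ, X = (t c hc).X i)).FullSubcategory ≌
                w.heart.FullSubcategory,
            Nonempty (Idempotents.toKaroubi _ ⋙ e.functor ⋙ w.heart.ι ≅
              (WeightStr.smallProducts
                (fun X => ∃ c hc, ∃ i : ℤ, X = (t c hc).X i)).ι)) := by
  have hS : ∀ X, S X → WeightStr.FactorsFinitely X := fun X hX => (hcocompact X hX).factorsFinitely
  have htri := WeightStr.cogen_isTriangulated hshift
  have : HasProducts.{0} C := has_smallest_products_of_hasProducts.{v}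
  let w := WeightStr.cogeneratedWeightStructure hS hshift
  have hgew : w.ge ≤ WeightStr.cogen S := WeightStr.coenvelope_le_cogen S
  let w' := w.restrict (WeightStr.cogen S) hgew
  have hcogen := WeightStr.cogen_closedUnderSmallProducts S
  have hone := (WeightStr.classOne_closedUnderSmallProducts hS).inf hcogen
  have hle : WeightStr.ClosedUnderSmallProducts w'.le := hcogen.inverseImage_ι hone
  have hge : WeightStr.ClosedUnderSmallProducts w'.ge :=
    hcogen.inverseImage_ι (WeightStr.coenvelope_isCoenvelopeClosed S).prod
  have hheart := WeightStr.WeightStructure.heart_closedUnderSmallProducts hle hge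
  have := hcogen.hasProducts
  have := WeightStr.cogen_isStableUnderRetracts hshift
  have := WeightStr.coenvelope_isStableUnderRetracts hshift
  have hC : IsIdempotentComplete C := WeightStr.isIdempotentComplete_of_hasCountablePowers
  have hD : IsIdempotentComplete (WeightStr.cogen S).FullSubcategory :=
    WeightStr.isIdempotentComplete_fullSubcategory _
  have hH : IsIdempotentComplete w'.heart.FullSubcategory :=
    WeightStr.isIdempotentComplete_fullSubcategory _
  refine ⟨⟨w, rfl, rfl⟩, WeightStr.perp_isTriangulated hshift,
    WeightStr.perp_closedUnderSmallProducts hS hshift,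
    hcogen, fun E hE hE' hprod hSE => WeightStr.cogen_le hE hE' hprod hSE,
    (WeightStr.le_coenvelope S).trans (WeightStr.coenvelope_le_cogen S), htri, hgew, w', rfl, rfl,
    WeightStr.restrict_nonDegenerateFromBelow hshift rfl hgew,
    WeightStr.classOne_eq_extensionClosure hS hshift,
    hone, hheart, w'.productsOfDecompositions hle hge, w'.productsOfWeightTowers hge hle,
    WeightStr.WeightStructure.productsOfWeightComplexes hge hle, hC, hD,
    WeightStr.isIdempotentComplete_fullSubcategory _,
    WeightStr.isIdempotentComplete_fullSubcategory _,
    WeightStr.isIdempotentComplete_fullSubcategory _, w'.exists_isWeightComplex, fun t ht => ?_⟩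
  have hT : (fun X => ∃ c hc, ∃ i : ℤ, X = (t c hc).X i) ≤ w'.heart := by
    rintro _ ⟨c, hc, i, rfl⟩
    exact (ht c hc).heart_X i
  refine WeightStr.exists_karoubi_equivalence_fullSubcategory (WeightStr.smallProducts_le hheart hT)
    (WeightStr.WeightStructure.heart_restrict_le_retractClosure (w := w) (S := S) rfl hcogen hgew
      hheart hT
      fun X hX => ?_)
  obtain ⟨B, A, b, a, f, hdist, ⟨ρ⟩, hA⟩ :=
    (ht X hX).exists_approximation (WeightStr.le_coenvelope S X.obj hX)
  -- The zeroth terms of the weight complexes suffice to approximate the generators.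
  exact ⟨⟨B, A, b, a, f, hdist, ⟨_, ⟨X, hX, 0, rfl⟩, ⟨ρ⟩⟩, hA⟩⟩
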